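/- Let $n\ge 0$ be an integer, let $M$ be a smooth manifold of dimension $n+1$ without boundary (not necessarily compact or complete), and let $g$ be a smooth Riemannian metric on $M$ with Levi-Civita connection $\nabla$ and Ricci tensor $\mathrm{Rc}_g$. Let $\Delta_g=d^*d=-\operatorname{tr}_g\nabla^2$ be the (nonnegative) scalar Laplacian. Suppose that $\mathrm{Rc}_g\ge -n\,g$, that is, $\mathrm{Rc}_g(v,v)\ge -n\,g(v,v)$ for every tangent vector $v$, and let $u\in C^3(M)$ be a real-valued solution of $$(\Delta_g+n+1)u=0 \quad\text{on } M.$$ Then $|du|_g^2-u^2$ is of class $C^2$ and subharmonic, that is, $\Delta_g(|du|_g^2-u^2)\le 0$ on $M$. More precisely, at every point of $M$, $$\Delta_g\big(|du|_g^2-u^2\big)=-2\,\langle(\mathrm{Rc}_g+n)\,du,du\rangle_g-2\,|b|_g^2\le 0,$$ where $b=\nabla^2u+\frac1{n+1}(\Delta_gu)\,g$ is the traceless Hessian of $u$, $|b|_g^2=g^{ik}g^{jl}b_{ij}b_{kl}$, and $\langle(\mathrm{Rc}_g+n)\,du,du\rangle_g=R_{ij}u^iu^j+n\,|du|_g^2$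 with $u^i=g^{ij}\partial_ju$. -/

import Mathlib

open scoped Manifold ContDiff Bundle

noncomputable section

/-! ### Classical tensor calculus in coordinates

`G : ℝᵐ → Matrix` is the matrix `(g_ij)` of a metric and `f` a function, both read in a chart;
`i, j, k, l : Fin m`. -/

namespace Coord

variable {m : ℕ}

/-- The partial derivative `∂_i f (x)`. -/
def pd (i : Fin m) (f : EuclideanSpace ℝ (Fin m) → ℝ) (x : EuclideanSpace ℝ (Fin m)) : ℝ :=
  fderiv ℝ f x (EuclideanSpace.single i 1)

/-- The Christoffel symbol
`Γ^k_ij = ½ g^{kl} (∂_i g_jl + ∂_j g_il - ∂_l g_ij)` of the Levi-Civita connection. -/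
def christoffel (G : EuclideanSpace ℝ (Fin m) → Matrix (Fin m) (Fin m) ℝ) (k i j : Fin m)
    (x : EuclideanSpace ℝ (Fin m)) : ℝ :=
  (1 / 2) * ∑ l, (G x)⁻¹ k l *
    (pd i (fun y => G y j l) x + pd j (fun y => G y i l) x - pd l (fun y => G y i j) x)

/-- The covariant Hessian `f_ij = ∂_i ∂_j f - Γ^k_ij ∂_k f`. -/
def hessian (G : EuclideanSpace ℝ (Fin m) → Matrix (Fin m) (Fin m) ℝ)
    (f : EuclideanSpace ℝ (Fin m) → ℝ) (i j : Fin m) (x : EuclideanSpace ℝ (Fin m)) : ℝ :=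
  pd i (pd j f) x - ∑ k, christoffel G k i j x * pd k f x

/-- The Ricci curvature
`R_ij = ∂_k Γ^k_ij - ∂_j Γ^k_ik + Γ^k_kl Γ^l_ij - Γ^k_jl Γ^l_ik`
(positive on round spheres). -/
def ricci (G : EuclideanSpace ℝ (Fin m) → Matrix (Fin m) (Fin m) ℝ) (i j : Fin m)
    (x : EuclideanSpace ℝ (Fin m)) : ℝ :=
  (∑ k, pd k (christoffel G k i j) x) - (∑ k, pd j (christoffel G k i k) x)
    + (∑ k, ∑ l, christoffel G k k l x * christoffel G l i j x)
    - ∑ k, ∑ l, christoffel G k j l x * christoffel G l i k x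

/-- The Laplacian `d^*d f = - g^{ij} f_ij`, a nonnegative operator. -/
def laplacian (G : EuclideanSpace ℝ (Fin m) → Matrix (Fin m) (Fin m) ℝ)
    (f : EuclideanSpace ℝ (Fin m) → ℝ) (x : EuclideanSpace ℝ (Fin m)) : ℝ :=
  -∑ i, ∑ j, (G x)⁻¹ i j * hessian G f i j x

end Coord

/-! ### Smooth Riemannian metrics on manifolds without boundary -/

/-- A smooth Riemannian metric on the `m`-dimensional manifold `M`. -/
abbrev SmoothMetric (m : ℕ) (M : Type*) [TopologicalSpace M]
    [ChartedSpace (EuclideanSpace ℝ (Fin m)) M] [IsManifold (𝓡 m) ∞ M] : Type _ :=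
  Bundle.ContMDiffRiemannianMetric (𝓡 m) ∞ (EuclideanSpace ℝ (Fin m))
    (fun p : M => TangentSpace (𝓡 m) p)

namespace SmoothMetric

variable {m : ℕ} {M : Type*} [TopologicalSpace M]
  [ChartedSpace (EuclideanSpace ℝ (Fin m)) M]

/-- The coordinate vector field `∂_i` of the chart `e`, at the point with coordinates `x`. -/
def coordVec (e : OpenPartialHomeomorph M (EuclideanSpace ℝ (Fin m)))
    (x : EuclideanSpace ℝ (Fin m)) (i : Fin m) : TangentSpace (𝓡 m) (e.symm x) :=
  mfderiv (𝓡 m) (𝓡 m) e.symm x (EuclideanSpace.single i (1 : ℝ) : EuclideanSpace ℝ (Fin m))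

variable [IsManifold (𝓡 m) ∞ M]

/-- The matrix `g_ij = g(∂_i, ∂_j)` of the metric in the chart `e`. -/
def gram (g : SmoothMetric m M) (e : OpenPartialHomeomorph M (EuclideanSpace ℝ (Fin m)))
    (x : EuclideanSpace ℝ (Fin m)) : Matrix (Fin m) (Fin m) ℝ :=
  Matrix.of fun i j => g.inner (e.symm x) (coordVec e x i) (coordVec e x j)

/-! The objects below do not depend on the chart that is used to compute them at `p`; we take
the preferred chart `chartAt _ p` around `p`. -/

/-- The scalar Laplacian `Δ_g u = d^*d u` at `p`. -/
def laplacian (g : SmoothMetric m M) (u : M → ℝ) (p : M) : ℝ :=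
  let e := chartAt (EuclideanSpace ℝ (Fin m)) p
  Coord.laplacian (g.gram e) (u ∘ e.symm) (e p)

/-- The Ricci tensor `Rc_g(v, w) = R_ij v^i w^j`, where `v^i = dx^i(v)`. -/
def ricci (g : SmoothMetric m M) (p : M) (v w : TangentSpace (𝓡 m) p) : ℝ :=
  let e := chartAt (EuclideanSpace ℝ (Fin m)) p
  let v' : EuclideanSpace ℝ (Fin m) := mfderiv (𝓡 m) (𝓡 m) e p v
  let w' : EuclideanSpace ℝ (Fin m) := mfderiv (𝓡 m) (𝓡 m) e p w
  ∑ i, ∑ j, Coord.ricci (g.gram e) i j (e p) * v' i * w' j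

/-- The component `u^i = g^{ij} ∂_j u` of the gradient, in the preferred chart around `p`. -/
def gradComp (g : SmoothMetric m M) (u : M → ℝ) (p : M) (i : Fin m) : ℝ :=
  let e := chartAt (EuclideanSpace ℝ (Fin m)) p
  ∑ j, (g.gram e (e p))⁻¹ i j * Coord.pd j (u ∘ e.symm) (e p)

/-- `|du|_g² = g^{ij} ∂_i u ∂_j u`. -/
def normSqDu (g : SmoothMetric m M) (u : M → ℝ) (p : M) : ℝ :=
  let e := chartAt (EuclideanSpace ℝ (Fin m)) p
  ∑ i, ∑ j, (g.gram e (e p))⁻¹ i j * Coord.pd i (u ∘ e.symm) (e p) * Coord.pd j (u ∘ e.symm) (e p)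

/-- `⟨(Rc_g + c) du, du⟩_g = R_ij u^i u^j + c |du|_g²`. -/
def ricciAddDuDu (g : SmoothMetric m M) (c : ℝ) (u : M → ℝ) (p : M) : ℝ :=
  let e := chartAt (EuclideanSpace ℝ (Fin m)) p
  (∑ i, ∑ j, Coord.ricci (g.gram e) i j (e p) * g.gradComp u p i * g.gradComp u p j)
    + c * g.normSqDu u p

/-- The component `b_ij` of the traceless Hessian `b = ∇²u + (1/m) (Δ_g u) g` (as `Δ_g` is minus
the trace of the Hessian, this has trace zero), in the preferred chart around `p`. -/
def tracelessHessian (g : SmoothMetric m M) (u : M → ℝ) (p : M) (i j : Fin m) : ℝ :=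
  let e := chartAt (EuclideanSpace ℝ (Fin m)) p
  Coord.hessian (g.gram e) (u ∘ e.symm) i j (e p) + (1 / m) * g.laplacian u p * g.gram e (e p) i j

/-- `|b|_g² = g^{ik} g^{jl} b_ij b_kl` for the traceless Hessian `b` of `u`. -/
def normSqTracelessHessian (g : SmoothMetric m M) (u : M → ℝ) (p : M) : ℝ :=
  let e := chartAt (EuclideanSpace ℝ (Fin m)) p
  ∑ i, ∑ j, ∑ k, ∑ l, (g.gram e (e p))⁻¹ i k * (g.gram e (e p))⁻¹ j l
    * g.tracelessHessian u p i j * g.tracelessHessian u p k l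

/-- A `C²` function `f` is subharmonic if `Δ_g f ≤ 0` for `Δ_g = d^*d`, the nonnegative
Laplacian. -/
def IsSubharmonic (g : SmoothMetric m M) (f : M → ℝ) : Prop :=
  ContMDiff (𝓡 m) 𝓘(ℝ, ℝ) 2 f ∧ ∀ p, g.laplacian f p ≤ 0

end SmoothMetric

end

/-! The equation makes every term of Bochner's formula explicit. With the nonnegative Laplacian that
formula reads Δ|du|² = -2|∇²u|² + 2⟨du, dΔu⟩ - 2 Rc(∇u, ∇u), and Δu = -(n+1)u turns the middle term
into -2(n+1)|du|². Subtracting Δ(u²) = 2uΔu - 2|du|² leaves -2(Rc + n)(∇u, ∇u) - 2(|∇²u|² -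
(n+1)u²). Since ∇²u has trace (n+1)u, the last bracket is the squared norm of the traceless Hessian.
The Ricci bound at ∇u and positivity of g⁻¹ give the sign.

Bochner's formula (`Coord.IsMetricOn.bochner`) is proved in one chart. Metric compatibility
(`pd_inv`, `pd_pairing`) differentiates |df|² covariantly; the Ricci identity, symmetry of the
Hessian and skew-adjointness of the curvature turn g^{lk} f_{ki;l} into -∂_i Δf + R_ki f^k.

The global objects at a point are computed in the preferred chart of that point, which varies, while
the formula differentiates |du|² and Δu in a fixed chart. Hence both must be shown independent of
the chart. For the Laplacian this is done without transforming Christoffel symbols: a Koszul formula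
writes the Hessian through iterated products ⟨da, d⟨db, df⟩⟩, which involve first derivatives only
and are visibly invariant (`SmoothMetric.laplacian_eq_of_charts`). -/

noncomputable section

open Filter Topology

local notation "E" m => EuclideanSpace ℝ (Fin m)

namespace Coord

variable {m : ℕ}

/-! ### Calculus of partial derivatives -/

section PartialDerivatives

variable {f h : (E m) → ℝ} {x : E m}

theorem pd_sub (i : Fin m) (hf : DifferentiableAt ℝ f x) (hh : DifferentiableAt ℝ h x) :
    pd i (fun y => f y - h y) x = pd i f x - pd i h x := by
  simp only [pd]
  rw [fderiv_fun_sub hf hh]; rfl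

theorem pd_neg (i : Fin m) : pd i (fun y => -f y) x = -pd i f x := by
  simp only [pd]
  rw [fderiv_fun_neg]; rfl

theorem pd_mul (i : Fin m) (hf : DifferentiableAt ℝ f x) (hh : DifferentiableAt ℝ h x) :
    pd i (fun y => f y * h y) x = pd i f x * h x + f x * pd i h x := by
  simp only [pd]
  rw [fderiv_fun_mul hf hh]
  simp
  ring

theorem pd_const_mul (i : Fin m) (c : ℝ) (hf : DifferentiableAt ℝ f x) :
    pd i (fun y => c * f y) x = c * pd i f x := by
  simp only [pd]
  rw [fderiv_const_mul hf]; rfl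

theorem pd_const (i : Fin m) (c : ℝ) : pd i (fun _ => c) x = 0 := by
  simp [pd]

theorem pd_sum {ι : Type*} (s : Finset ι) {F : ι → (E m) → ℝ} (i : Fin m)
    (hF : ∀ k, DifferentiableAt ℝ (F k) x) :
    pd i (fun y => ∑ k ∈ s, F k y) x = ∑ k ∈ s, pd i (F k) x := by
  simp only [pd]
  rw [fderiv_fun_sum fun k _ => hF k]
  simp

theorem pd_congr (i : Fin m) (hfh : f =ᶠ[𝓝 x] h) : pd i f x = pd i h x := by
  simp only [pd, hfh.fderiv_eq]

theorem pd_eventuallyEq (i : Fin m) (hfh : f =ᶠ[𝓝 x] h) : pd i f =ᶠ[𝓝 x] pd i h :=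
  hfh.eventuallyEq_nhds.mono fun _ hy => pd_congr i hy

theorem contDiffAt_pd {n k : WithTop ℕ∞} (i : Fin m) (hf : ContDiffAt ℝ n f x)
    (hk : k + 1 ≤ n) : ContDiffAt ℝ k (pd i f) x :=
  (hf.fderiv_right hk).clm_apply contDiffAt_const

theorem pd_comm (i j : Fin m) (hf : ContDiffAt ℝ 2 f x) : pd i (pd j f) x = pd j (pd i f) x := by
  have hd : DifferentiableAt ℝ (fderiv ℝ f) x :=
    (hf.fderiv_right (m := 1) (by norm_num)).differentiableAt (by norm_num)
  have key : ∀ v w : E m, fderiv ℝ (fun y => fderiv ℝ f y v) x w = fderiv ℝ (fderiv ℝ f) x w v := by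
    intro v w
    rw [fderiv_clm_apply hd (differentiableAt_const v)]
    simp
  have hs : IsSymmSndFDerivAt ℝ f x := hf.isSymmSndFDerivAt (by simp)
  change fderiv ℝ (fun y => fderiv ℝ f y _) x _ = fderiv ℝ (fun y => fderiv ℝ f y _) x _
  rw [key, key]
  exact hs _ _

end PartialDerivatives

theorem sum_swap_outer {ι κ : Type*} [Fintype ι] [Fintype κ] (F : ι → κ → ι → ℝ) :
    ∑ i, ∑ j, ∑ k, F i j k = ∑ i, ∑ j, ∑ k, F k j i := by
  rw [Finset.sum_comm, Finset.sum_comm (γ := ι) (α := κ)]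
  exact Finset.sum_congr rfl fun j _ => Finset.sum_comm

/-! ### Smoothness of determinants and inverse matrices -/

section MatrixSmoothness

variable {k : ℕ} {n : WithTop ℕ∞} {x : E m}

theorem contDiffAt_det {G : (E m) → Matrix (Fin k) (Fin k) ℝ}
    (hG : ∀ i j, ContDiffAt ℝ n (fun y => G y i j) x) : ContDiffAt ℝ n (fun y => (G y).det) x := by
  simp only [Matrix.det_apply]
  refine ContDiffAt.sum fun σ _ => ContDiffAt.const_smul _ ?_
  exact contDiffAt_prod fun i _ => hG _ _

/-- Cramer's rule: an entry of the inverse is a determinant of entries and constants divided by the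
nonvanishing determinant. -/
theorem contDiffAt_inv {G : (E m) → Matrix (Fin k) (Fin k) ℝ}
    (hG : ∀ i j, ContDiffAt ℝ n (fun y => G y i j) x) (h0 : (G x).det ≠ 0) (i j : Fin k) :
    ContDiffAt ℝ n (fun y => (G y)⁻¹ i j) x := by
  simp only [Matrix.inv_def, Matrix.smul_apply, Ring.inverse_eq_inv', smul_eq_mul,
    Matrix.adjugate_apply]
  refine ((contDiffAt_det hG).inv h0).mul (contDiffAt_det fun a b => ?_)
  by_cases h : a = j
  · subst h
    simp only [Matrix.updateRow_self]
    exact contDiffAt_const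
  · simp only [Matrix.updateRow_ne h]
    exact hG a b

end MatrixSmoothness

/-- `G` is a smooth nondegenerate symmetric matrix field on the open set `U`. -/
structure IsMetricOn (G : (E m) → Matrix (Fin m) (Fin m) ℝ) (U : Set (E m)) : Prop where
  isOpen : IsOpen U
  smooth : ∀ x ∈ U, ∀ i j, ContDiffAt ℝ ∞ (fun y => G y i j) x
  symm : ∀ x ∈ U, ∀ i j, G x i j = G x j i
  det_ne : ∀ x ∈ U, (G x).det ≠ 0

/-- The inner product `g^{ij} ∂_i a ∂_j b` of the differentials of `a` and `b`. -/
def dot (G : (E m) → Matrix (Fin m) (Fin m) ℝ) (a b : (E m) → ℝ) (x : E m) : ℝ :=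
  ∑ i, ∑ j, (G x)⁻¹ i j * pd i a x * pd j b x

/-- The covariant derivative `(∇_l α)_i = ∂_l α_i - Γ^k_li α_k` of a covector field. -/
def covDeriv (G : (E m) → Matrix (Fin m) (Fin m) ℝ) (α : Fin m → (E m) → ℝ) (l i : Fin m)
    (x : E m) : ℝ :=
  pd l (α i) x - ∑ k, christoffel G k l i x * α k x

theorem hessian_eq_covDeriv (G : (E m) → Matrix (Fin m) (Fin m) ℝ) (f : (E m) → ℝ) (i j : Fin m)
    (x : E m) : hessian G f i j x = covDeriv G (fun k => pd k f) i j x := rfl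

/-! ### The Levi-Civita connection and metric compatibility -/

namespace IsMetricOn

variable {G : (E m) → Matrix (Fin m) (Fin m) ℝ} {U : Set (E m)} {x : E m}

theorem eventually_mem (hG : IsMetricOn G U) (hx : x ∈ U) : ∀ᶠ y in 𝓝 x, y ∈ U :=
  hG.isOpen.mem_nhds hx

theorem inv_symm (hG : IsMetricOn G U) (hx : x ∈ U) (i j : Fin m) : (G x)⁻¹ i j = (G x)⁻¹ j i := by
  have h : (G x).transpose = G x := by
    ext a b
    exact hG.symm x hx b a
  have := congrFun (congrFun (Matrix.transpose_nonsing_inv (G x)) i) j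
  rw [h] at this
  exact this.symm

theorem inv_mul (hG : IsMetricOn G U) (hx : x ∈ U) : (G x)⁻¹ * G x = 1 :=
  Matrix.nonsing_inv_mul _ (hG.det_ne x hx).isUnit

theorem mul_inv (hG : IsMetricOn G U) (hx : x ∈ U) : G x * (G x)⁻¹ = 1 :=
  Matrix.mul_nonsing_inv _ (hG.det_ne x hx).isUnit

theorem inv_smooth (hG : IsMetricOn G U) (hx : x ∈ U) (i j : Fin m) :
    ContDiffAt ℝ ∞ (fun y => (G y)⁻¹ i j) x :=
  contDiffAt_inv (hG.smooth x hx) (hG.det_ne x hx) i j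

theorem pd_smooth (hG : IsMetricOn G U) (hx : x ∈ U) (k i j : Fin m) :
    ContDiffAt ℝ ∞ (pd k (fun y => G y i j)) x :=
  contDiffAt_pd k (hG.smooth x hx i j) (by simp)

theorem christoffel_smooth (hG : IsMetricOn G U) (hx : x ∈ U) (k i j : Fin m) :
    ContDiffAt ℝ ∞ (christoffel G k i j) x := by
  unfold christoffel
  refine contDiffAt_const.mul (ContDiffAt.sum fun l _ => (hG.inv_smooth hx k l).mul ?_)
  exact ((hG.pd_smooth hx _ _ _).add (hG.pd_smooth hx _ _ _)).sub (hG.pd_smooth hx _ _ _)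

theorem pd_symm (hG : IsMetricOn G U) (hx : x ∈ U) (k i j : Fin m) :
    pd k (fun y => G y i j) x = pd k (fun y => G y j i) x :=
  pd_congr k ((hG.eventually_mem hx).mono fun y hy => hG.symm y hy i j)

theorem christoffel_symm (hG : IsMetricOn G U) (hx : x ∈ U) (k i j : Fin m) :
    christoffel G k i j x = christoffel G k j i x := by
  unfold christoffel
  congr 1
  refine Finset.sum_congr rfl fun l _ => ?_
  rw [hG.pd_symm hx l i j]
  ring

/-- Lowering the upper index cancels the inverse metric in the definition; this is `G * G⁻¹ = 1`
applied to the vector of bracketed derivatives. -/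
theorem lower_christoffel (hG : IsMetricOn G U) (hx : x ∈ U) (a i j : Fin m) :
    ∑ k, G x a k * christoffel G k i j x
      = (1 / 2) * (pd i (fun y => G y j a) x + pd j (fun y => G y i a) x
        - pd a (fun y => G y i j) x) := by
  have h := congrFun (congrArg (fun A : Matrix (Fin m) (Fin m) ℝ => A.mulVec fun l =>
    (1 / 2) * (pd i (fun y => G y j l) x + pd j (fun y => G y i l) x - pd l (fun y => G y i j) x))
    (hG.mul_inv hx)) a
  simp only [Matrix.one_mulVec, ← Matrix.mulVec_mulVec] at h
  rw [← h]
  simp only [Matrix.mulVec, dotProduct, christoffel, Finset.mul_sum]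
  refine Finset.sum_congr rfl fun k _ => Finset.sum_congr rfl fun l _ => ?_
  ring

/-- Metric compatibility, for the metric. -/
theorem pd_metric (hG : IsMetricOn G U) (hx : x ∈ U) (k i j : Fin m) :
    pd k (fun y => G y i j) x
      = (∑ l, G x i l * christoffel G l k j x) + ∑ l, G x j l * christoffel G l k i x := by
  rw [hG.lower_christoffel hx, hG.lower_christoffel hx, hG.pd_symm hx k j i, hG.pd_symm hx j k i,
    hG.pd_symm hx i k j, hG.pd_symm hx i j k, hG.pd_symm hx j i k]
  rw [hG.pd_symm hx i k j, hG.pd_symm hx j k i]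
  ring

/-- Metric compatibility, for the inverse metric. -/
theorem pd_inv (hG : IsMetricOn G U) (hx : x ∈ U) (k i j : Fin m) :
    pd k (fun y => (G y)⁻¹ i j) x
      = -(∑ l, christoffel G i k l x * (G x)⁻¹ l j) - ∑ l, (G x)⁻¹ i l * christoffel G j k l x := by
  set P := (G x)⁻¹ with hP
  let Γ : Matrix (Fin m) (Fin m) ℝ := Matrix.of fun a b => christoffel G a k b x
  let DP : Matrix (Fin m) (Fin m) ℝ := Matrix.of fun a b => pd k (fun y => (G y)⁻¹ a b) x
  let DG : Matrix (Fin m) (Fin m) ℝ := Matrix.of fun a b => pd k (fun y => G y a b) x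
  have hDG : DG = G x * Γ + Γ.transpose * G x := by
    ext a b
    simp only [DG, Γ, Matrix.of_apply, hG.pd_metric hx, Matrix.add_apply, Matrix.mul_apply,
      Matrix.transpose_apply]
    congr 1
    exact Finset.sum_congr rfl fun l _ => by rw [hG.symm x hx b l, mul_comm]
  -- The derivative of the constant matrix g⁻¹g, valid because g⁻¹g = 1 on a whole neighbourhood.
  have h0 : DP * G x + P * DG = 0 := by
    ext a b
    have h1 : pd k (fun y => ∑ l, (G y)⁻¹ a l * G y l b) x = 0 := by
      rw [pd_congr k (h := fun _ => (1 : Matrix (Fin m) (Fin m) ℝ) a b), pd_const]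
      filter_upwards [hG.eventually_mem hx] with y hy
      rw [← hG.inv_mul hy, Matrix.mul_apply]
    rw [pd_sum _ _ fun l => ((hG.inv_smooth hx a l).mul (hG.smooth x hx l b)).differentiableAt
      (by simp)] at h1
    rw [Matrix.zero_apply, ← h1]
    simp only [Matrix.add_apply, Matrix.mul_apply, ← Finset.sum_add_distrib, DP, DG,
      Matrix.of_apply]
    refine Finset.sum_congr rfl fun l _ => ?_
    rw [pd_mul k ((hG.inv_smooth hx a l).differentiableAt (by simp))
      ((hG.smooth x hx l b).differentiableAt (by simp))]
  -- Multiply `h0` on the right by g⁻¹ and insert ∂g = gΓ + Γᵀg.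
  have h2 : DP = -(Γ * P) - P * Γ.transpose := by
    have h3 : DP * (G x * P) = -(P * DG * P) := by
      rw [← mul_assoc, eq_neg_of_add_eq_zero_left h0, neg_mul]
    rw [hG.mul_inv hx, mul_one, hDG] at h3
    rw [h3, mul_add, ← mul_assoc, hG.inv_mul hx, one_mul, add_mul, mul_assoc P (_ * _),
      mul_assoc Γ.transpose, hG.mul_inv hx, mul_one, neg_add, sub_eq_add_neg]
  have h4 := congrFun (congrFun h2 i) j
  simpa [DP, Γ, Matrix.mul_apply] using h4

theorem hessian_symm (hG : IsMetricOn G U) (hx : x ∈ U) {f : (E m) → ℝ} (hf : ContDiffAt ℝ 2 f x)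
    (i j : Fin m) : hessian G f i j x = hessian G f j i x := by
  unfold hessian
  rw [pd_comm i j hf]
  simp only [hG.christoffel_symm hx _ i j]

theorem hessian_contDiffAt (hG : IsMetricOn G U) (hx : x ∈ U) {f : (E m) → ℝ}
    (hf : ContDiffAt ℝ 3 f x) (i j : Fin m) : ContDiffAt ℝ 1 (hessian G f i j) x := by
  unfold hessian
  have h2 : ∀ j, ContDiffAt ℝ 2 (pd j f) x := fun j => contDiffAt_pd j hf (by norm_num)
  refine (contDiffAt_pd i (h2 j) (by norm_num)).sub (ContDiffAt.sum fun k _ => ?_)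
  exact ((hG.christoffel_smooth hx k i j).of_le (by simp)).mul ((h2 k).of_le (by norm_num))

/-- The derivative of the pairing of two covector fields. -/
theorem pd_pairing (hG : IsMetricOn G U) (hx : x ∈ U) {α β : Fin m → (E m) → ℝ}
    (hα : ∀ i, DifferentiableAt ℝ (α i) x) (hβ : ∀ i, DifferentiableAt ℝ (β i) x) (l : Fin m) :
    pd l (fun y => ∑ i, ∑ j, (G y)⁻¹ i j * α i y * β j y) x
      = (∑ i, ∑ j, (G x)⁻¹ i j * covDeriv G α l i x * β j x)
        + ∑ i, ∑ j, (G x)⁻¹ i j * α i x * covDeriv G β l j x := by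
  have hP : ∀ i j, DifferentiableAt ℝ (fun y => (G y)⁻¹ i j) x := fun i j =>
    (hG.inv_smooth hx i j).differentiableAt (by simp)
  rw [pd_sum _ _ fun i => DifferentiableAt.fun_sum fun j _ =>
    ((hP i j).fun_mul (hα i)).fun_mul (hβ j)]
  have h1 : ∀ i, pd l (fun y => ∑ j, (G y)⁻¹ i j * α i y * β j y) x
      = ∑ j, (pd l (fun y => (G y)⁻¹ i j) x * α i x * β j x
        + (G x)⁻¹ i j * pd l (α i) x * β j x + (G x)⁻¹ i j * α i x * pd l (β j) x) := by
    intro i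
    rw [pd_sum _ _ fun j => ((hP i j).fun_mul (hα i)).fun_mul (hβ j)]
    refine Finset.sum_congr rfl fun j _ => ?_
    rw [pd_mul l ((hP i j).fun_mul (hα i)) (hβ j), pd_mul l (hP i j) (hα i)]
    ring
  simp only [h1, hG.pd_inv hx, covDeriv]
  -- After relabelling, the two Christoffel terms of ∂g⁻¹ are the corrections that turn ∂α and ∂β
  -- into covariant derivatives.
  have e1 : ∑ i, ∑ j, (∑ k, christoffel G i l k x * (G x)⁻¹ k j) * α i x * β j x
      = ∑ i, ∑ j, (G x)⁻¹ i j * (∑ k, christoffel G k l i x * α k x) * β j x := by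
    simp only [Finset.sum_mul, Finset.mul_sum]
    rw [sum_swap_outer]
    exact Finset.sum_congr rfl fun i _ => Finset.sum_congr rfl fun j _ =>
      Finset.sum_congr rfl fun k _ => by ring
  have e2 : ∑ i, ∑ j, (∑ k, (G x)⁻¹ i k * christoffel G j l k x) * α i x * β j x
      = ∑ i, ∑ j, (G x)⁻¹ i j * α i x * (∑ k, christoffel G k l j x * β k x) := by
    simp only [Finset.sum_mul, Finset.mul_sum]
    refine Finset.sum_congr rfl fun i _ => ?_
    rw [Finset.sum_comm]
    refine Finset.sum_congr rfl fun j _ => Finset.sum_congr rfl fun k _ => by ring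
  simp only [sub_mul, mul_sub, neg_mul, Finset.sum_add_distrib, Finset.sum_sub_distrib,
    Finset.sum_neg_distrib, e1, e2]
  ring

end IsMetricOn

end Coord

/-! ### Curvature, the Ricci identity and Bochner's formula in a chart -/

namespace Coord

variable {m : ℕ}

/-- The gradient `f^i = g^{ij} ∂_j f`. -/
def grad (G : (E m) → Matrix (Fin m) (Fin m) ℝ) (f : (E m) → ℝ) (x : E m) (i : Fin m) : ℝ :=
  ∑ j, (G x)⁻¹ i j * pd j f x

/-- The curvature `∂_l Γ^a_kj - ∂_k Γ^a_lj + Γ^a_lb Γ^b_kj - Γ^a_kb Γ^b_lj`. -/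
def curvature (G : (E m) → Matrix (Fin m) (Fin m) ℝ) (l k a j : Fin m) (x : E m) : ℝ :=
  pd l (christoffel G a k j) x - pd k (christoffel G a l j) x
    + ∑ b, (christoffel G a l b x * christoffel G b k j x
      - christoffel G a k b x * christoffel G b l j x)

/-- The second covariant derivative of the differential of `f`:
`f_kj;l = ∂_l f_kj - Γ^a_lj f_ka - Γ^a_lk f_aj`. -/
def thirdDeriv (G : (E m) → Matrix (Fin m) (Fin m) ℝ) (f : (E m) → ℝ) (l k j : Fin m)
    (x : E m) : ℝ :=
  covDeriv G (hessian G f k) l j x - ∑ a, christoffel G a l k x * hessian G f a j x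

theorem dot_comm {G : (E m) → Matrix (Fin m) (Fin m) ℝ} {U : Set (E m)} {x : E m}
    (hG : IsMetricOn G U) (hx : x ∈ U) (a b : (E m) → ℝ) : dot G a b x = dot G b a x := by
  unfold dot
  rw [Finset.sum_comm]
  refine Finset.sum_congr rfl fun i _ => Finset.sum_congr rfl fun j _ => ?_
  rw [hG.inv_symm hx]
  ring

theorem dot_eq_sum_mul_grad (G : (E m) → Matrix (Fin m) (Fin m) ℝ) (a b : (E m) → ℝ) (x : E m) :
    dot G a b x = ∑ i, pd i a x * grad G b x i := by
  simp only [dot, grad, Finset.mul_sum]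
  exact Finset.sum_congr rfl fun i _ => Finset.sum_congr rfl fun j _ => by ring

namespace IsMetricOn

variable {G : (E m) → Matrix (Fin m) (Fin m) ℝ} {U : Set (E m)} {x : E m} {a b f : (E m) → ℝ}

theorem sum_inv_mul (hG : IsMetricOn G U) (hx : x ∈ U) (v w : Fin m → ℝ) :
    ∑ i, ∑ j, (G x)⁻¹ i j * v i * w j = ∑ j, (∑ i, (G x)⁻¹ j i * v i) * w j := by
  rw [Finset.sum_comm]
  refine Finset.sum_congr rfl fun i _ => ?_
  rw [Finset.sum_mul]
  refine Finset.sum_congr rfl fun j _ => ?_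
  rw [hG.inv_symm hx]

theorem differentiableAt_pd (hf : ContDiffAt ℝ 2 f x) (i : Fin m) :
    DifferentiableAt ℝ (pd i f) x :=
  (contDiffAt_pd (k := 1) i hf (by norm_num)).differentiableAt (by norm_num)

theorem dot_contDiffAt (hG : IsMetricOn G U) (hx : x ∈ U) {n : ℕ} (ha : ContDiffAt ℝ (n + 1) a x)
    (hb : ContDiffAt ℝ (n + 1) b x) : ContDiffAt ℝ n (dot G a b) x := by
  unfold dot
  refine ContDiffAt.sum fun i _ => ContDiffAt.sum fun j _ => ?_
  exact (((hG.inv_smooth hx i j).of_le (by exact_mod_cast le_top)).mul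
    (contDiffAt_pd i ha le_rfl)).mul (contDiffAt_pd j hb le_rfl)

/-- The derivative of the inner product of two differentials. -/
theorem pd_dot (hG : IsMetricOn G U) (hx : x ∈ U) (ha : ContDiffAt ℝ 2 a x)
    (hb : ContDiffAt ℝ 2 b x) (k : Fin m) :
    pd k (dot G a b) x
      = (∑ i, hessian G a k i x * grad G b x i) + ∑ i, hessian G b k i x * grad G a x i := by
  have h := hG.pd_pairing hx (α := fun i => pd i a) (β := fun i => pd i b)
    (differentiableAt_pd ha) (differentiableAt_pd hb) k
  change pd k (dot G a b) x = _ at h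
  rw [h, hG.sum_inv_mul hx (fun i => pd i a x)]
  simp only [grad, Finset.mul_sum, hessian_eq_covDeriv, Finset.sum_mul]
  congr 1
  · exact Finset.sum_congr rfl fun i _ => Finset.sum_congr rfl fun j _ => by ring
  · exact Finset.sum_congr rfl fun i _ => Finset.sum_congr rfl fun j _ => by ring

theorem dot_dot (hG : IsMetricOn G U) (hx : x ∈ U) (ha : ContDiffAt ℝ 2 a x)
    (hb : ContDiffAt ℝ 2 b x) (f : (E m) → ℝ) :
    dot G f (dot G a b) x
      = (∑ i, ∑ j, hessian G a i j x * grad G f x i * grad G b x j)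
        + ∑ i, ∑ j, hessian G b i j x * grad G f x i * grad G a x j := by
  rw [dot_comm hG hx, dot_eq_sum_mul_grad]
  simp only [hG.pd_dot hx ha hb, add_mul, Finset.sum_add_distrib, Finset.sum_mul]
  congr 1
  · exact Finset.sum_congr rfl fun i _ => Finset.sum_congr rfl fun j _ => by ring
  · exact Finset.sum_congr rfl fun i _ => Finset.sum_congr rfl fun j _ => by ring

/-- The Hessian expressed through iterated inner products of differentials. -/
theorem koszul (hG : IsMetricOn G U) (hx : x ∈ U) (ha : ContDiffAt ℝ 2 a x)
    (hb : ContDiffAt ℝ 2 b x) (hf : ContDiffAt ℝ 2 f x) :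
    2 * ∑ i, ∑ j, hessian G f i j x * grad G a x i * grad G b x j
      = dot G a (dot G b f) x + dot G b (dot G a f) x - dot G f (dot G a b) x := by
  have swap : ∀ {p : (E m) → ℝ}, ContDiffAt ℝ 2 p x → ∀ q r : (E m) → ℝ,
      ∑ i, ∑ j, hessian G p i j x * grad G q x i * grad G r x j
        = ∑ i, ∑ j, hessian G p i j x * grad G r x i * grad G q x j := by
    intro p hp q r
    rw [Finset.sum_comm]
    refine Finset.sum_congr rfl fun i _ => Finset.sum_congr rfl fun j _ => ?_
    rw [hG.hessian_symm hx hp]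
    ring
  -- By symmetry the Hessians of `a` and `b` occur once with each sign and cancel, while that of `f`
  -- occurs twice.
  rw [hG.dot_dot hx hb hf, hG.dot_dot hx ha hf, hG.dot_dot hx ha hb, swap hb f a, swap ha f b,
    swap hf b a]
  ring

theorem christoffel_differentiableAt (hG : IsMetricOn G U) (hx : x ∈ U) (k i j : Fin m) :
    DifferentiableAt ℝ (christoffel G k i j) x :=
  (hG.christoffel_smooth hx k i j).differentiableAt (by simp)

theorem inv_differentiableAt (hG : IsMetricOn G U) (hx : x ∈ U) (i j : Fin m) :
    DifferentiableAt ℝ (fun y => (G y)⁻¹ i j) x :=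
  (hG.inv_smooth hx i j).differentiableAt (by simp)

/-- The curvature is skew-adjoint. -/
theorem curvature_skew (hG : IsMetricOn G U) (hx : x ∈ U) (l k a c : Fin m) :
    (∑ b, curvature G l k a b x * (G x)⁻¹ b c)
      = -∑ b, (G x)⁻¹ a b * curvature G l k c b x := by
  set P := (G x)⁻¹ with hP
  let Γ : Fin m → Matrix (Fin m) (Fin m) ℝ := fun k => Matrix.of fun a b => christoffel G a k b x
  let DΓ : Fin m → Fin m → Matrix (Fin m) (Fin m) ℝ :=
    fun l k => Matrix.of fun a b => pd l (christoffel G a k b) x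
  let DDP : Fin m → Fin m → Matrix (Fin m) (Fin m) ℝ :=
    fun l k => Matrix.of fun a b => pd l (pd k fun y => (G y)⁻¹ a b) x
  let F : Matrix (Fin m) (Fin m) ℝ := Matrix.of fun a b => curvature G l k a b x
  have hF : F = DΓ l k - DΓ k l + (Γ l * Γ k - Γ k * Γ l) := by
    ext a b
    simp only [F, DΓ, Γ, curvature, Matrix.add_apply, Matrix.sub_apply, Matrix.mul_apply,
      Matrix.of_apply, Finset.sum_sub_distrib]
  have hDDP : ∀ l k, DDP l k = -(DΓ l k * P + Γ k * (-(Γ l * P) - P * (Γ l).transpose))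
      - ((-(Γ l * P) - P * (Γ l).transpose) * (Γ k).transpose + P * (DΓ l k).transpose) := by
    intro l k
    ext a b
    have h1 : pd l (pd k fun y => (G y)⁻¹ a b) x
        = pd l (fun y => -(∑ c, christoffel G a k c y * (G y)⁻¹ c b)
          - ∑ c, (G y)⁻¹ a c * christoffel G b k c y) x :=
      pd_congr l ((hG.eventually_mem hx).mono fun y hy => hG.pd_inv hy k a b)
    have d1 : ∀ c, DifferentiableAt ℝ (fun y => christoffel G a k c y * (G y)⁻¹ c b) x :=
      fun c => (hG.christoffel_differentiableAt hx a k c).mul (hG.inv_differentiableAt hx c b)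
    have d2 : ∀ c, DifferentiableAt ℝ (fun y => (G y)⁻¹ a c * christoffel G b k c y) x :=
      fun c => (hG.inv_differentiableAt hx a c).mul (hG.christoffel_differentiableAt hx b k c)
    rw [pd_sub l (DifferentiableAt.fun_sum fun c _ => d1 c).fun_neg
      (DifferentiableAt.fun_sum fun c _ => d2 c), pd_neg, pd_sum _ _ d1, pd_sum _ _ d2] at h1
    have h2 : ∀ c, pd l (fun y => christoffel G a k c y * (G y)⁻¹ c b) x = _ := fun c =>
      pd_mul l (hG.christoffel_differentiableAt hx a k c) (hG.inv_differentiableAt hx c b)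
    have h3 : ∀ c, pd l (fun y => (G y)⁻¹ a c * christoffel G b k c y) x = _ := fun c =>
      pd_mul l (hG.inv_differentiableAt hx a c) (hG.christoffel_differentiableAt hx b k c)
    simp only [h2, h3, hG.pd_inv hx, Finset.sum_add_distrib] at h1
    simpa only [DDP, DΓ, Γ, Matrix.of_apply, Matrix.add_apply, Matrix.sub_apply, Matrix.neg_apply,
      Matrix.mul_apply, Matrix.transpose_apply] using h1
  -- Mixed partials of g⁻¹ commute. In the difference of the two expansions the terms Γ P Γᵀ cancel,
  -- and what is left is -(FP + PFᵀ).
  have hsymm : DDP l k = DDP k l := by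
    ext a b
    exact pd_comm l k ((hG.inv_smooth hx a b).of_le ENat.LEInfty.out)
  rw [hDDP, hDDP] at hsymm
  have h0 : F * P = -(P * F.transpose) := by
    rw [eq_neg_iff_add_eq_zero, hF]
    simp only [Matrix.transpose_add, Matrix.transpose_sub, Matrix.transpose_mul]
    rw [← sub_eq_zero] at hsymm
    rw [← neg_eq_zero, ← hsymm]
    noncomm_ring
  have h1 := congrFun (congrFun h0 a) c
  simpa only [F, Matrix.mul_apply, Matrix.neg_apply, Matrix.transpose_apply, Matrix.of_apply]
    using h1

theorem ricci_eq_sum_curvature (hG : IsMetricOn G U) (hx : x ∈ U) (i j : Fin m) :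
    ricci G i j x = ∑ l, curvature G l j l i x := by
  have h1 : ∀ l k a b, pd l (christoffel G k a b) x = pd l (christoffel G k b a) x := fun l k a b =>
    pd_congr l ((hG.eventually_mem hx).mono fun y hy => hG.christoffel_symm hy k a b)
  simp only [ricci, curvature, Finset.sum_add_distrib, Finset.sum_sub_distrib]
  simp only [h1 _ _ i, hG.christoffel_symm hx _ i]
  ring

theorem thirdDeriv_symm (hG : IsMetricOn G U) (hx : x ∈ U) (hf : ContDiffAt ℝ 3 f x)
    (l k j : Fin m) : thirdDeriv G f l k j x = thirdDeriv G f l j k x := by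
  have hev : ∀ᶠ y in 𝓝 x, ContDiffAt ℝ 3 f y := hf.eventually (by simp)
  have h1 : pd l (hessian G f k j) x = pd l (hessian G f j k) x :=
    pd_congr l ((hG.eventually_mem hx).and hev |>.mono fun y hy =>
      hG.hessian_symm hy.1 (hy.2.of_le (by norm_num)) k j)
  have h2 := hG.hessian_symm hx (hf.of_le (show (2 : WithTop ℕ∞) ≤ 3 by norm_num))
  simp only [thirdDeriv, covDeriv, h1, h2 k, h2 _ j]
  ring

/-- The Ricci identity for the differential of a function. -/
theorem ricci_identity (hG : IsMetricOn G U) (hx : x ∈ U) (hf : ContDiffAt ℝ 3 f x)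
    (l k j : Fin m) :
    thirdDeriv G f l k j x
      = thirdDeriv G f k l j x - ∑ a, curvature G l k a j x * pd a f x := by
  have hd : ∀ i, ContDiffAt ℝ 2 (pd i f) x := fun i => contDiffAt_pd i hf (by norm_num)
  have h1 : ∀ l k, pd l (hessian G f k j) x = pd l (pd k (pd j f)) x
      - ∑ a, (pd l (christoffel G a k j) x * pd a f x
        + christoffel G a k j x * pd l (pd a f) x) := by
    intro l k
    have d : ∀ a, DifferentiableAt ℝ (fun y => christoffel G a k j y * pd a f y) x := fun a =>
      (hG.christoffel_differentiableAt hx a k j).mul ((hd a).differentiableAt (by norm_num))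
    change pd l (fun y => pd k (pd j f) y - ∑ a, christoffel G a k j y * pd a f y) x = _
    rw [pd_sub l (differentiableAt_pd (hd j) k) (DifferentiableAt.fun_sum fun a _ => d a),
      pd_sum _ _ d]
    congr 1
    exact Finset.sum_congr rfl fun a _ => pd_mul l (hG.christoffel_differentiableAt hx a k j)
      ((hd a).differentiableAt (by norm_num))
  -- Third partials and the correction in Γ^a_lk are symmetric in `l` and `k`, as is the sum of the
  -- terms Γ·∂∂f; only derivatives and products of Christoffel symbols survive the exchange.
  simp only [thirdDeriv, covDeriv, h1, pd_comm l k (hd j), hG.christoffel_symm hx _ l k, curvature,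
    add_mul, sub_mul, Finset.sum_add_distrib, Finset.sum_sub_distrib, Finset.sum_mul]
  simp only [hessian, mul_sub, Finset.sum_sub_distrib, Finset.mul_sum]
  have e : ∀ l k, ∑ a, ∑ b, christoffel G a l j x * (christoffel G b k a x * pd b f x)
      = ∑ a, ∑ b, christoffel G a k b x * christoffel G b l j x * pd a f x := by
    intro l k
    rw [Finset.sum_comm]
    exact Finset.sum_congr rfl fun a _ => Finset.sum_congr rfl fun b _ => by ring
  rw [e, e]
  ring

/-- Contraction with g⁻¹ commutes with covariant differentiation: the Christoffel terms of `pd_inv`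
match those inside `thirdDeriv`. -/
theorem sum_inv_mul_thirdDeriv (hG : IsMetricOn G U) (hx : x ∈ U) (hf : ContDiffAt ℝ 3 f x)
    (i : Fin m) :
    ∑ l, ∑ k, (G x)⁻¹ l k * thirdDeriv G f i l k x = -pd i (laplacian G f) x := by
  have dH : ∀ l k, DifferentiableAt ℝ (hessian G f l k) x := fun l k =>
    (hG.hessian_contDiffAt hx hf l k).differentiableAt (by norm_num)
  have d : ∀ l k, DifferentiableAt ℝ (fun y => (G y)⁻¹ l k * hessian G f l k y) x := fun l k =>
    (hG.inv_differentiableAt hx l k).mul (dH l k)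
  have h1 : pd i (laplacian G f) x = -∑ l, ∑ k, (pd i (fun y => (G y)⁻¹ l k) x * hessian G f l k x
      + (G x)⁻¹ l k * pd i (hessian G f l k) x) := by
    change pd i (fun y => -∑ l, ∑ k, (G y)⁻¹ l k * hessian G f l k y) x = _
    rw [pd_neg, pd_sum _ _ fun l => DifferentiableAt.fun_sum fun k _ => d l k]
    congr 1
    refine Finset.sum_congr rfl fun l _ => ?_
    rw [pd_sum _ _ fun k => d l k]
    exact Finset.sum_congr rfl fun k _ => pd_mul i (hG.inv_differentiableAt hx l k) (dH l k)
  rw [h1, neg_neg]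
  simp only [thirdDeriv, covDeriv, hG.pd_inv hx]
  have e1 : ∑ l, ∑ k, (∑ a, christoffel G l i a x * (G x)⁻¹ a k) * hessian G f l k x
      = ∑ l, ∑ k, (G x)⁻¹ l k * ∑ a, christoffel G a i l x * hessian G f a k x := by
    simp only [Finset.sum_mul, Finset.mul_sum]
    rw [sum_swap_outer]
    exact Finset.sum_congr rfl fun i _ => Finset.sum_congr rfl fun j _ =>
      Finset.sum_congr rfl fun k _ => by ring
  have e2 : ∑ l, ∑ k, (∑ a, (G x)⁻¹ l a * christoffel G k i a x) * hessian G f l k x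
      = ∑ l, ∑ k, (G x)⁻¹ l k * ∑ a, christoffel G a i k x * hessian G f l a x := by
    simp only [Finset.sum_mul, Finset.mul_sum]
    refine Finset.sum_congr rfl fun i _ => ?_
    rw [Finset.sum_comm]
    exact Finset.sum_congr rfl fun j _ => Finset.sum_congr rfl fun k _ => by ring
  simp only [sub_mul, mul_sub, neg_mul, Finset.sum_add_distrib, Finset.sum_sub_distrib,
    Finset.sum_neg_distrib, e1, e2]
  ring

/-- The divergence of the Hessian. Symmetry and the Ricci identity move the derivative index `l`
into the traced pair, at the cost of a curvature term contracted in the wrong slots;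
skew-adjointness (`h1`) brings that term to the trace defining Ricci. -/
theorem sum_inv_mul_thirdDeriv_last (hG : IsMetricOn G U) (hx : x ∈ U) (hf : ContDiffAt ℝ 3 f x)
    (i : Fin m) :
    ∑ l, ∑ k, (G x)⁻¹ l k * thirdDeriv G f l k i x
      = -pd i (laplacian G f) x + ∑ k, ricci G k i x * grad G f x k := by
  simp only [hG.thirdDeriv_symm hx hf _ _ i, hG.ricci_identity hx hf _ i, mul_sub,
    Finset.sum_sub_distrib, hG.sum_inv_mul_thirdDeriv hx hf, hG.ricci_eq_sum_curvature hx]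
  rw [sub_eq_add_neg]
  congr 1
  have h1 : ∀ l, ∑ k, (G x)⁻¹ l k * ∑ a, curvature G l i a k x * pd a f x
      = -∑ k, curvature G l i l k x * grad G f x k := by
    intro l
    calc ∑ k, (G x)⁻¹ l k * ∑ a, curvature G l i a k x * pd a f x
        = ∑ a, (∑ k, curvature G l i a k x * (G x)⁻¹ k l) * pd a f x := by
          simp only [Finset.mul_sum, Finset.sum_mul]
          rw [Finset.sum_comm]
          refine Finset.sum_congr rfl fun a _ => Finset.sum_congr rfl fun k _ => ?_
          rw [hG.inv_symm hx l k]
          ring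
      _ = -∑ k, curvature G l i l k x * grad G f x k := by
          simp only [hG.curvature_skew hx, grad, Finset.mul_sum, Finset.sum_mul, neg_mul,
            Finset.sum_neg_distrib]
          rw [Finset.sum_comm]
          congr 1
          refine Finset.sum_congr rfl fun a _ => Finset.sum_congr rfl fun k _ => ?_
          rw [hG.inv_symm hx a k]
          ring
  simp only [h1, Finset.sum_neg_distrib, neg_neg, Finset.sum_mul]
  rw [Finset.sum_comm]

/-- The Bochner formula. -/
theorem bochner (hG : IsMetricOn G U) (hx : x ∈ U) (hf : ContDiffAt ℝ 3 f x) :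
    laplacian G (dot G f f) x
      = -2 * (∑ i, ∑ j, ∑ k, ∑ l, (G x)⁻¹ i k * (G x)⁻¹ j l * hessian G f i j x * hessian G f k l x)
        + 2 * (∑ i, grad G f x i * pd i (laplacian G f) x)
        - 2 * ∑ i, ∑ j, ricci G i j x * grad G f x i * grad G f x j := by
  have hf2 : ContDiffAt ℝ 2 f x := hf.of_le (by norm_num)
  have hev : ∀ᶠ y in 𝓝 x, ContDiffAt ℝ 3 f y := hf.eventually (by simp)
  -- Needed near `x` and not only at `x`, since it is differentiated again; the explicit g⁻¹ gives
  -- the shape required by `pd_pairing`, with covector fields ∇_k df and df.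
  have h1 : ∀ y ∈ U, ContDiffAt ℝ 3 f y → ∀ k, pd k (dot G f f) y
      = 2 * ∑ i, ∑ j, (G y)⁻¹ i j * hessian G f k i y * pd j f y := by
    intro y hy hfy k
    rw [hG.pd_dot hy (hfy.of_le (by norm_num)) (hfy.of_le (by norm_num)), two_mul]
    have : ∑ i, hessian G f k i y * grad G f y i
        = ∑ i, ∑ j, (G y)⁻¹ i j * hessian G f k i y * pd j f y := by
      simp only [grad, Finset.mul_sum]
      exact Finset.sum_congr rfl fun i _ => Finset.sum_congr rfl fun j _ => by ring
    rw [this]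
  have dH : ∀ k i, DifferentiableAt ℝ (hessian G f k i) x := fun k i =>
    (hG.hessian_contDiffAt hx hf k i).differentiableAt (by norm_num)
  have h2 : ∀ l k, pd l (pd k (dot G f f)) x
      = 2 * ((∑ i, covDeriv G (hessian G f k) l i x * grad G f x i)
        + ∑ i, ∑ j, (G x)⁻¹ i j * hessian G f k i x * hessian G f l j x) := by
    intro l k
    rw [pd_congr l (((hG.eventually_mem hx).and hev).mono fun y hy => h1 y hy.1 hy.2 k),
      pd_const_mul l 2 (DifferentiableAt.fun_sum fun i _ => DifferentiableAt.fun_sum fun j _ =>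
        ((hG.inv_differentiableAt hx i j).fun_mul (dH k i)).fun_mul (differentiableAt_pd hf2 j)),
      hG.pd_pairing hx (dH k) (differentiableAt_pd hf2)]
    congr 2
    simp only [grad, Finset.mul_sum]
    exact Finset.sum_congr rfl fun i _ => Finset.sum_congr rfl fun j _ => by ring
  have h3 : ∀ k, pd k (dot G f f) x = 2 * ∑ i, hessian G f k i x * grad G f x i := by
    intro k
    rw [hG.pd_dot hx hf2 hf2, two_mul]
  -- The Christoffel term of this Hessian is the correction in the index `k` that completes
  -- `covDeriv` to `thirdDeriv`.
  have h4 : ∀ l k, hessian G (dot G f f) l k x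
      = 2 * ((∑ i, thirdDeriv G f l k i x * grad G f x i)
        + ∑ i, ∑ j, (G x)⁻¹ i j * hessian G f k i x * hessian G f l j x) := by
    intro l k
    have : ∑ a, christoffel G a l k x * (2 * ∑ i, hessian G f a i x * grad G f x i)
        = 2 * ∑ i, (∑ a, christoffel G a l k x * hessian G f a i x) * grad G f x i := by
      simp only [Finset.mul_sum, Finset.sum_mul]
      rw [Finset.sum_comm]
      exact Finset.sum_congr rfl fun i _ => Finset.sum_congr rfl fun j _ => by ring
    have hh : hessian G (dot G f f) l k x = pd l (pd k (dot G f f)) x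
      - ∑ a, christoffel G a l k x * pd a (dot G f f) x := rfl
    rw [hh, h2]
    simp only [h3]
    rw [this]
    simp only [thirdDeriv, sub_mul, Finset.sum_sub_distrib]
    ring
  have h5 : ∑ l, ∑ k, (G x)⁻¹ l k * ∑ i, thirdDeriv G f l k i x * grad G f x i
      = -(∑ i, grad G f x i * pd i (laplacian G f) x)
        + ∑ i, ∑ j, ricci G i j x * grad G f x i * grad G f x j := by
    calc ∑ l, ∑ k, (G x)⁻¹ l k * ∑ i, thirdDeriv G f l k i x * grad G f x i
        = ∑ i, (∑ l, ∑ k, (G x)⁻¹ l k * thirdDeriv G f l k i x) * grad G f x i := by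
          simp only [Finset.mul_sum, Finset.sum_mul]
          symm
          rw [Finset.sum_comm]
          refine Finset.sum_congr rfl fun l _ => ?_
          rw [Finset.sum_comm]
          exact Finset.sum_congr rfl fun i _ => Finset.sum_congr rfl fun j _ => by ring
      _ = _ := by
          simp only [hG.sum_inv_mul_thirdDeriv_last hx hf, add_mul, Finset.sum_add_distrib,
            neg_mul, Finset.sum_neg_distrib, Finset.sum_mul]
          rw [Finset.sum_comm (f := fun i k => ricci G k i x * grad G f x k * grad G f x i)]
          congr 2
          exact Finset.sum_congr rfl fun i _ => by ring
  have h6 : ∑ l, ∑ k, (G x)⁻¹ l k *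
        ∑ i, ∑ j, (G x)⁻¹ i j * hessian G f k i x * hessian G f l j x
      = ∑ i, ∑ j, ∑ k, ∑ l, (G x)⁻¹ i k * (G x)⁻¹ j l * hessian G f i j x * hessian G f k l x := by
    refine Finset.sum_congr rfl fun i _ => ?_
    rw [Finset.sum_comm (s := Finset.univ) (t := Finset.univ)
      (f := fun j k => ∑ l, (G x)⁻¹ i k * (G x)⁻¹ j l * hessian G f i j x * hessian G f k l x)]
    refine Finset.sum_congr rfl fun k _ => ?_
    simp only [Finset.mul_sum]
    rw [Finset.sum_comm]
    refine Finset.sum_congr rfl fun j _ => Finset.sum_congr rfl fun l _ => ?_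
    rw [hG.inv_symm hx j l]
    ring
  unfold laplacian at *
  simp only [h4, mul_left_comm _ (2 : ℝ), mul_add, Finset.sum_add_distrib]
  simp only [← Finset.mul_sum]
  rw [h6, h5]
  ring

end IsMetricOn

end Coord

/-! ### Coordinate frames and the Gram matrix of a chart -/

namespace SmoothMetric

variable {m : ℕ} {M : Type*} [TopologicalSpace M]
  [ChartedSpace (EuclideanSpace ℝ (Fin m)) M]

/-- The coordinate frame of the chart `e`, as tangent vectors at `p`. -/
def frame (e : OpenPartialHomeomorph M (E m)) (p : M) (i : Fin m) : TangentSpace (𝓡 m) p :=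
  (coordVec e (e p) i : E m)

/-- The components `dx^i(v)` of the tangent vector `v` in the chart `e`. -/
def comp (e : OpenPartialHomeomorph M (E m)) (p : M) (v : TangentSpace (𝓡 m) p) : E m :=
  mfderiv (𝓡 m) (𝓡 m) e p v

variable [IsManifold (𝓡 m) ∞ M] (g : SmoothMetric m M)

theorem gram_eq_inner_frame {e : OpenPartialHomeomorph M (E m)} {p : M} (hp : p ∈ e.source)
    (i j : Fin m) : g.gram e (e p) i j = g.inner p (frame e p i) (frame e p j) := by
  -- The vectors `coordVec` sit at `e.symm (e p)`, which equals `p` only propositionally. All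
  -- tangent spaces are the same model space, so the base point can be generalized and substituted.
  have h : ∀ q (v w : E m), q = p →
      g.inner q (show TangentSpace (𝓡 m) q from v) (show TangentSpace (𝓡 m) q from w)
      = g.inner p (show TangentSpace (𝓡 m) p from v) (show TangentSpace (𝓡 m) p from w) := by
    rintro q v w rfl
    rfl
  exact h _ (coordVec e (e p) i) (coordVec e (e p) j) (e.left_inv hp)

variable {e e' : OpenPartialHomeomorph M (E m)} {p : M}

theorem mdifferentiable_chart (he : e ∈ atlas (E m) M) : e.MDifferentiable (𝓡 m) (𝓡 m) :=
  mdifferentiable_of_mem_atlas he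

theorem map_eq_sum_single {F : Type*} [NormedAddCommGroup F] [NormedSpace ℝ F]
    (L : (E m) →L[ℝ] F) (v : E m) : L v = ∑ i, v i • L (EuclideanSpace.single i (1 : ℝ)) := by
  have h : v = ∑ i, v i • EuclideanSpace.single i (1 : ℝ) := by
    ext j
    simp [Finset.sum_apply, Pi.single_apply]
  conv_lhs => rw [h]
  simp only [map_sum, map_smul]

theorem eq_sum_comp_smul_frame (he : e ∈ atlas (E m) M) (hp : p ∈ e.source)
    (v : TangentSpace (𝓡 m) p) : v = ∑ i, comp e p v i • frame e p i := by
  have h1 : mfderiv (𝓡 m) (𝓡 m) e.symm (e p) (comp e p v) = v := by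
    have := congrArg (fun L => L v) ((mdifferentiable_chart he).symm_comp_deriv hp)
    exact this
  have h2 : (mfderiv (𝓡 m) (𝓡 m) e.symm (e p) : (E m) →L[ℝ] (E m)) (comp e p v)
      = ∑ i, comp e p v i • (mfderiv (𝓡 m) (𝓡 m) e.symm (e p) : (E m) →L[ℝ] (E m))
        (EuclideanSpace.single i (1 : ℝ)) := by
    exact map_eq_sum_single (F := E m) _ _
  exact h1.symm.trans h2

theorem comp_sum_smul_frame (he : e ∈ atlas (E m) M) (hp : p ∈ e.source) (w : E m) :
    comp e p (∑ i, w i • frame e p i) = w := by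
  have h2 : (mfderiv (𝓡 m) (𝓡 m) e.symm (e p) : (E m) →L[ℝ] (E m)) w
      = ∑ i, w i • (mfderiv (𝓡 m) (𝓡 m) e.symm (e p) : (E m) →L[ℝ] (E m))
        (EuclideanSpace.single i (1 : ℝ)) := by
    exact map_eq_sum_single (F := E m) _ _
  have h3 := congrArg (fun L => L w) ((mdifferentiable_chart he).comp_symm_deriv (e.map_source hp))
  have h4 : ∀ q (z : E m), q = p →
    (mfderiv (𝓡 m) (𝓡 m) e q : (E m) →L[ℝ] (E m)) z
      = (mfderiv (𝓡 m) (𝓡 m) e p : (E m) →L[ℝ] (E m)) z := by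
    rintro q z rfl
    rfl
  refine Eq.trans ?_ h3
  refine Eq.trans ?_ (h4 _ _ (e.left_inv hp)).symm
  exact congrArg (mfderiv (𝓡 m) (𝓡 m) e p : (E m) →L[ℝ] (E m)) h2.symm

theorem inner_eq_sum_gram (he : e ∈ atlas (E m) M) (hp : p ∈ e.source)
    (v w : TangentSpace (𝓡 m) p) :
    g.inner p v w = ∑ i, ∑ j, g.gram e (e p) i j * comp e p v i * comp e p w j := by
  conv_lhs => rw [eq_sum_comp_smul_frame he hp v, eq_sum_comp_smul_frame he hp w]
  simp only [map_sum, map_smul, sum_apply, smul_apply,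
    smul_eq_mul, g.gram_eq_inner_frame hp,
    Finset.mul_sum]
  rw [Finset.sum_comm]
  exact Finset.sum_congr rfl fun i _ => Finset.sum_congr rfl fun j _ => by ring

/-- The components of a vector in the frame are unique, so a nonzero coefficient vector gives a
nonzero tangent vector, on which `g` is positive. -/
theorem gram_posDef (he : e ∈ atlas (E m) M) (hp : p ∈ e.source) : (g.gram e (e p)).PosDef := by
  refine Matrix.PosDef.of_dotProduct_mulVec_pos ?_ fun {w} hw => ?_
  · ext i j
    simp only [Matrix.conjTranspose_apply, star_trivial, g.gram_eq_inner_frame hp, g.symm p]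
  · set w' : E m := WithLp.toLp 2 w with hw'
    set v : TangentSpace (𝓡 m) p := ∑ i, w' i • frame e p i with hv
    have hc : comp e p v = w' := comp_sum_smul_frame he hp w'
    have hv0 : v ≠ 0 := by
      intro h
      rw [h] at hc
      apply hw
      have h0 : comp e p (0 : TangentSpace (𝓡 m) p) = 0 := map_zero (mfderiv (𝓡 m) (𝓡 m) e p)
      rw [h0] at hc
      funext i
      exact (congrArg (fun z : E m => z i) hc).symm
    have := g.pos p v hv0
    rw [g.inner_eq_sum_gram he hp, hc] at this
    simp only [dotProduct, Matrix.mulVec, Finset.mul_sum, star_trivial, Pi.star_apply]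
    refine this.trans_eq (Finset.sum_congr rfl fun i _ => Finset.sum_congr rfl fun j _ => ?_)
    change _ * w i * w j = _
    ring

theorem mem_maximalAtlas (he : e ∈ atlas (E m) M) : e ∈ IsManifold.maximalAtlas (𝓡 m) ∞ M :=
  IsManifold.subset_maximalAtlas he

/-- The field ∂_i is the image of a constant field under the tangent map of the smooth map `e.symm`.
-/
theorem contMDiffOn_coordVec (he : e ∈ atlas (E m) M) (i : Fin m) :
    ContMDiffOn (𝓡 m) (𝓡 m).tangent ∞
      (fun y => (⟨e.symm y, coordVec e y i⟩ : TangentBundle (𝓡 m) M)) e.target := by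
  have h1 := (contMDiffOn_symm_of_mem_maximalAtlas (mem_maximalAtlas he)).contMDiffOn_tangentMapWithin
    (m := ∞) (by simp) e.open_target.uniqueMDiffOn
  have h2 : ContMDiffOn (𝓡 m) (𝓡 m).tangent ∞ (fun y : E m =>
      (⟨y, (EuclideanSpace.single i (1 : ℝ) : E m)⟩ : TangentBundle (𝓡 m) (E m))) e.target := by
    refine fun y hy => contMDiffWithinAt_vectorSpace_iff_contDiffWithinAt.2 ?_
    exact contDiffWithinAt_const
  refine (h1.comp h2 fun y hy => hy).congr fun y hy => ?_
  simp only [Function.comp, tangentMapWithin, coordVec]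
  rw [mfderivWithin_of_isOpen e.open_target hy]

theorem gram_contDiffAt (he : e ∈ atlas (E m) M) {x : E m} (hx : x ∈ e.target) (i j : Fin m) :
    ContDiffAt ℝ ∞ (fun y => g.gram e y i j) x := by
  have hs := (contMDiffAt_symm_of_mem_maximalAtlas (mem_maximalAtlas he) hx)
  have h1 := g.contMDiff.contMDiffAt (x := e.symm x) |>.comp x hs
  have hv := fun i => (contMDiffOn_coordVec he i).contMDiffAt (e.open_target.mem_nhds hx)
  have h2 := h1.clm_bundle_apply₂ (F₁ := E m) (F₂ := E m) (F₃ := ℝ)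
    (E₃ := Bundle.Trivial M ℝ) (hv i) (hv j)
  exact (Bundle.contMDiffAt_totalSpace.1 h2).2.contDiffAt

end SmoothMetric

namespace Coord

variable {m : ℕ}

theorem dot_congr (G : (E m) → Matrix (Fin m) (Fin m) ℝ) {a a' b b' : (E m) → ℝ} {x : E m}
    (ha : a =ᶠ[𝓝 x] a') (hb : b =ᶠ[𝓝 x] b') : dot G a b x = dot G a' b' x := by
  simp only [dot, pd_congr _ ha, pd_congr _ hb]

theorem dot_eq_dotProduct (G : (E m) → Matrix (Fin m) (Fin m) ℝ) (a b : (E m) → ℝ) (x : E m) :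
    dot G a b x = dotProduct (fun i => pd i a x) ((G x)⁻¹.mulVec fun i => pd i b x) := by
  simp only [dot, dotProduct, Matrix.mulVec, Finset.mul_sum]
  exact Finset.sum_congr rfl fun i _ => Finset.sum_congr rfl fun j _ => by ring

end Coord

/-! ### Independence of the chart -/

namespace SmoothMetric

theorem sum_comm_pairs {ι : Type*} [Fintype ι] (F : ι → ι → ι → ι → ℝ) :
    ∑ i, ∑ j, ∑ k, ∑ l, F i j k l = ∑ k, ∑ l, ∑ i, ∑ j, F i j k l := by
  have h := Finset.sum_comm (s := Finset.univ) (t := Finset.univ)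
    (f := fun (p q : ι × ι) => F p.1 p.2 q.1 q.2)
  simpa only [Fintype.sum_prod_type] using h

theorem comp_symm_eventuallyEq {H M : Type*} [TopologicalSpace H] [TopologicalSpace M]
    {e : OpenPartialHomeomorph M H} {p : M} {a b : M → ℝ} (hp : p ∈ e.source) (h : a =ᶠ[𝓝 p] b) :
    a ∘ e.symm =ᶠ[𝓝 (e p)] b ∘ e.symm := by
  have ht : Tendsto e.symm (𝓝 (e p)) (𝓝 p) := by
    have := (e.continuousAt_symm (e.map_source hp)).tendsto
    rwa [e.left_inv hp] at this
  exact ht.eventually h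

variable {m : ℕ} {M : Type*} [TopologicalSpace M] [ChartedSpace (E m) M]

/-- The matrix of the coordinate change from the frame of `e` to the frame of `e'`. -/
def jacobian (e e' : OpenPartialHomeomorph M (E m)) (p : M) : Matrix (Fin m) (Fin m) ℝ :=
  Matrix.of fun i j => comp e' p (frame e p i) j

variable [IsManifold (𝓡 m) ∞ M] (g : SmoothMetric m M)

/-- The inner product of the differentials of `a` and `b`, computed in the chart `e`. -/
def dotDu (e : OpenPartialHomeomorph M (E m)) (a b : M → ℝ) (p : M) : ℝ :=
  Coord.dot (g.gram e) (a ∘ e.symm) (b ∘ e.symm) (e p)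

variable {e e' : OpenPartialHomeomorph M (E m)} {p : M} {a b f : M → ℝ}

theorem isMetricOn (he : e ∈ atlas (E m) M) : Coord.IsMetricOn (g.gram e) e.target where
  isOpen := e.open_target
  smooth _ hx := g.gram_contDiffAt he hx
  symm x hx i j := by
    rw [← e.right_inv hx, g.gram_eq_inner_frame (e.map_target hx),
      g.gram_eq_inner_frame (e.map_target hx), g.symm]
  det_ne x hx := by
    rw [← e.right_inv hx]
    exact (g.gram_posDef he (e.map_target hx)).det_pos.ne'

theorem contDiffAt_comp_symm {n : ℕ} (he : e ∈ atlas (E m) M) (hp : p ∈ e.source)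
    (ha : ContMDiffAt (𝓡 m) 𝓘(ℝ, ℝ) n a p) : ContDiffAt ℝ n (a ∘ e.symm) (e p) := by
  rw [← contMDiffAt_iff_contDiffAt]
  have h := contMDiffAt_symm_of_mem_maximalAtlas (mem_maximalAtlas he) (e.map_source hp)
  refine ContMDiffAt.comp (e p) ?_ (h.of_le (by exact_mod_cast le_top))
  rwa [e.left_inv hp]

theorem contMDiffAt_comp_chart {n : ℕ} (he : e ∈ atlas (E m) M) (hp : p ∈ e.source)
    {F : (E m) → ℝ} (hF : ContDiffAt ℝ n F (e p)) :
    ContMDiffAt (𝓡 m) 𝓘(ℝ, ℝ) n (fun q => F (e q)) p :=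
  hF.contMDiffAt.comp p ((contMDiffAt_of_mem_maximalAtlas (mem_maximalAtlas he) hp).of_le
    (by exact_mod_cast le_top))

theorem contMDiffAt_coordinate {n : ℕ} (he : e ∈ atlas (E m) M) (hp : p ∈ e.source) (i : Fin m) :
    ContMDiffAt (𝓡 m) 𝓘(ℝ, ℝ) n (fun q => e q i) p :=
  contMDiffAt_comp_chart he hp (F := fun x => x i)
    (EuclideanSpace.proj (𝕜 := ℝ) i).contDiff.contDiffAt

theorem pd_comp_symm (he : e ∈ atlas (E m) M) (hp : p ∈ e.source)
    (ha : MDifferentiableAt (𝓡 m) 𝓘(ℝ, ℝ) a p) (i : Fin m) :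
    Coord.pd i (a ∘ e.symm) (e p) = mfderiv (𝓡 m) 𝓘(ℝ, ℝ) a p (frame e p i) := by
  have h1 : mfderiv (𝓡 m) 𝓘(ℝ, ℝ) (a ∘ e.symm) (e p) = _ :=
    mfderiv_comp (I' := 𝓡 m) (e p) (by rwa [e.left_inv hp])
      ((mdifferentiable_chart he).mdifferentiableAt_symm (e.map_source hp))
  rw [mfderiv_eq_fderiv] at h1
  have h4 : ∀ q (z : E m), q = p →
    (mfderiv (𝓡 m) 𝓘(ℝ, ℝ) a q : (E m) →L[ℝ] ℝ) z
      = (mfderiv (𝓡 m) 𝓘(ℝ, ℝ) a p : (E m) →L[ℝ] ℝ) z := by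
    rintro q z rfl
    rfl
  have h2 := congrArg (fun L : (E m) →L[ℝ] ℝ => L (EuclideanSpace.single i (1 : ℝ))) h1
  exact h2.trans (h4 _ _ (e.left_inv hp))

theorem frame_eq_sum (he' : e' ∈ atlas (E m) M) (hp' : p ∈ e'.source) (i : Fin m) :
    frame e p i = ∑ j, jacobian e e' p i j • frame e' p j :=
  eq_sum_comp_smul_frame he' hp' _

theorem pd_change_chart (he : e ∈ atlas (E m) M) (hp : p ∈ e.source) (he' : e' ∈ atlas (E m) M)
    (hp' : p ∈ e'.source) (ha : MDifferentiableAt (𝓡 m) 𝓘(ℝ, ℝ) a p) :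
    (fun i => Coord.pd i (a ∘ e.symm) (e p))
      = (jacobian e e' p).mulVec fun j => Coord.pd j (a ∘ e'.symm) (e' p) := by
  funext i
  rw [pd_comp_symm he hp ha, frame_eq_sum he' hp']
  simp only [Matrix.mulVec, dotProduct, pd_comp_symm he' hp' ha]
  have h : ∀ (L : TangentSpace (𝓡 m) p →L[ℝ] ℝ) (c : Fin m → ℝ) (v : Fin m → TangentSpace (𝓡 m) p),
      L (∑ j, c j • v j) = ∑ j, c j * L (v j) := by
    intro L c v
    simp only [map_sum, map_smul, smul_eq_mul]
  exact h (mfderiv (𝓡 m) 𝓘(ℝ, ℝ) a p) _ _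

theorem gram_change_chart (hp : p ∈ e.source) (he' : e' ∈ atlas (E m) M) (hp' : p ∈ e'.source) :
    g.gram e (e p)
      = jacobian e e' p * g.gram e' (e' p) * (jacobian e e' p).transpose := by
  ext i j
  rw [g.gram_eq_inner_frame hp, g.inner_eq_sum_gram he' hp']
  simp only [Matrix.mul_apply, Matrix.transpose_apply, jacobian, Matrix.of_apply, Finset.sum_mul]
  rw [Finset.sum_comm]
  exact Finset.sum_congr rfl fun i _ => Finset.sum_congr rfl fun j _ => by ring

theorem inv_gram_change_chart (he : e ∈ atlas (E m) M) (hp : p ∈ e.source)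
    (he' : e' ∈ atlas (E m) M) (hp' : p ∈ e'.source) :
    (g.gram e' (e' p))⁻¹
      = (jacobian e e' p).transpose * (g.gram e (e p))⁻¹ * jacobian e e' p := by
  set J := jacobian e e' p
  -- This exhibits a right inverse of `J`. For square matrices it is also a left inverse, so
  -- invertibility of `J` need not be known beforehand.
  have h1 : J * (g.gram e' (e' p) * J.transpose * (g.gram e (e p))⁻¹) = 1 := by
    rw [← (g.isMetricOn he).mul_inv (e.map_source hp)]
    conv_rhs => rw [g.gram_change_chart hp he' hp']
    simp only [mul_assoc]
    rw [g.gram_change_chart hp he' hp']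
    simp only [J, mul_assoc]
  apply Matrix.inv_eq_right_inv
  rw [← _root_.mul_eq_one_comm.1 h1]
  simp only [mul_assoc]

theorem dotDu_eq_of_charts (he : e ∈ atlas (E m) M) (hp : p ∈ e.source) (he' : e' ∈ atlas (E m) M)
    (hp' : p ∈ e'.source) (ha : MDifferentiableAt (𝓡 m) 𝓘(ℝ, ℝ) a p)
    (hb : MDifferentiableAt (𝓡 m) 𝓘(ℝ, ℝ) b p) : g.dotDu e a b p = g.dotDu e' a b p := by
  simp only [dotDu, Coord.dot_eq_dotProduct]
  rw [pd_change_chart he hp he' hp' ha, pd_change_chart he hp he' hp' hb,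
    g.inv_gram_change_chart he hp he' hp']
  simp only [← Matrix.mulVec_mulVec]
  rw [Matrix.dotProduct_mulVec _ (jacobian e e' p).transpose, Matrix.vecMul_transpose]

theorem dotDu_contMDiffAt {n : ℕ} (he : e ∈ atlas (E m) M) (hp : p ∈ e.source)
    (ha : ContMDiffAt (𝓡 m) 𝓘(ℝ, ℝ) (n + 1 : ℕ) a p)
    (hb : ContMDiffAt (𝓡 m) 𝓘(ℝ, ℝ) (n + 1 : ℕ) b p) :
    ContMDiffAt (𝓡 m) 𝓘(ℝ, ℝ) n (g.dotDu e a b) p := by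
  refine contMDiffAt_comp_chart he hp ?_
  exact (g.isMetricOn he).dot_contDiffAt (e.map_source hp)
    (by exact_mod_cast contDiffAt_comp_symm he hp ha)
    (by exact_mod_cast contDiffAt_comp_symm he hp hb)

theorem dotDu_comp_symm_eventuallyEq (hp : p ∈ e.source) :
    g.dotDu e a b ∘ e.symm =ᶠ[𝓝 (e p)] Coord.dot (g.gram e) (a ∘ e.symm) (b ∘ e.symm) := by
  filter_upwards [e.open_target.mem_nhds (e.map_source hp)] with y hy
  simp only [Function.comp, dotDu, e.right_inv hy]

theorem eventually_mdifferentiableAt (ha : ContMDiffAt (𝓡 m) 𝓘(ℝ, ℝ) 2 a p) :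
    ∀ᶠ q in 𝓝 p, MDifferentiableAt (𝓡 m) 𝓘(ℝ, ℝ) a q :=
  (contMDiffAt_iff_contMDiffAt_nhds (by simp) |>.1 ha).mono fun _ h => h.mdifferentiableAt (by norm_num)

/-- The inner products agree in both charts on a neighbourhood of `p`, hence have the same
differential there, and the outer product is invariant as well. -/
theorem dotDu_dotDu_eq_of_charts (he : e ∈ atlas (E m) M) (hp : p ∈ e.source)
    (he' : e' ∈ atlas (E m) M) (hp' : p ∈ e'.source) (ha : ContMDiffAt (𝓡 m) 𝓘(ℝ, ℝ) 2 a p)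
    (hb : ContMDiffAt (𝓡 m) 𝓘(ℝ, ℝ) 2 b p) (hf : ContMDiffAt (𝓡 m) 𝓘(ℝ, ℝ) 2 f p) :
    g.dotDu e f (g.dotDu e a b) p = g.dotDu e' f (g.dotDu e' a b) p := by
  rw [g.dotDu_eq_of_charts he hp he' hp' (hf.mdifferentiableAt (by norm_num))
    ((g.dotDu_contMDiffAt (n := 1) he hp ha hb).mdifferentiableAt (by norm_num))]
  refine Coord.dot_congr _ .rfl (comp_symm_eventuallyEq hp' ?_)
  filter_upwards [e.open_source.mem_nhds hp, e'.open_source.mem_nhds hp',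
    eventually_mdifferentiableAt ha, eventually_mdifferentiableAt hb] with q h1 h2 h3 h4
  exact g.dotDu_eq_of_charts he h1 he' h2 h3 h4

theorem koszul (he : e ∈ atlas (E m) M) (hp : p ∈ e.source)
    (ha : ContMDiffAt (𝓡 m) 𝓘(ℝ, ℝ) 2 a p)
    (hb : ContMDiffAt (𝓡 m) 𝓘(ℝ, ℝ) 2 b p) (hf : ContMDiffAt (𝓡 m) 𝓘(ℝ, ℝ) 2 f p) :
    2 * ∑ i, ∑ j, Coord.hessian (g.gram e) (f ∘ e.symm) i j (e p)
        * Coord.grad (g.gram e) (a ∘ e.symm) (e p) i * Coord.grad (g.gram e) (b ∘ e.symm) (e p) j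
      = g.dotDu e a (g.dotDu e b f) p + g.dotDu e b (g.dotDu e a f) p
        - g.dotDu e f (g.dotDu e a b) p := by
  rw [(g.isMetricOn he).koszul (e.map_source hp) (contDiffAt_comp_symm (n := 2) he hp ha)
    (contDiffAt_comp_symm (n := 2) he hp hb) (contDiffAt_comp_symm (n := 2) he hp hf)]
  have h : ∀ a b f : M → ℝ, g.dotDu e f (g.dotDu e a b) p = Coord.dot (g.gram e) (f ∘ e.symm)
      (Coord.dot (g.gram e) (a ∘ e.symm) (b ∘ e.symm)) (e p) := fun a b f =>
    Coord.dot_congr _ .rfl (g.dotDu_comp_symm_eventuallyEq hp)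
  simp only [h]

theorem pd_coordinate (he : e ∈ atlas (E m) M) (hp : p ∈ e.source) (he' : e' ∈ atlas (E m) M)
    (hp' : p ∈ e'.source) (i j : Fin m) :
    Coord.pd j ((fun q => e q i) ∘ e'.symm) (e' p) = jacobian e' e p j i := by
  rw [pd_comp_symm he' hp'
    ((contMDiffAt_coordinate (n := 1) he hp i).mdifferentiableAt (by norm_num))]
  have h1 : mfderiv (𝓡 m) 𝓘(ℝ, ℝ) ((EuclideanSpace.proj (𝕜 := ℝ) i : (E m) →L[ℝ] ℝ) ∘ e) p = _ :=
    mfderiv_comp (I' := 𝓡 m) p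
      (EuclideanSpace.proj (𝕜 := ℝ) i : (E m) →L[ℝ] ℝ).mdifferentiableAt
      ((mdifferentiable_chart he).mdifferentiableAt hp)
  rw [ContinuousLinearMap.mfderiv_eq] at h1
  exact congrArg (fun L : (E m) →L[ℝ] ℝ => L (frame e' p j)) h1

/-- The Laplacian computed in the chart `e'`, through the coordinate functions of the chart `e`. -/
theorem sum_gram_mul_koszul (he : e ∈ atlas (E m) M) (hp : p ∈ e.source) (he' : e' ∈ atlas (E m) M)
    (hp' : p ∈ e'.source) (hf : ContMDiffAt (𝓡 m) 𝓘(ℝ, ℝ) 2 f p) :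
    ∑ i, ∑ j, g.gram e (e p) i j *
        (g.dotDu e' (fun q => e q i) (g.dotDu e' (fun q => e q j) f) p
          + g.dotDu e' (fun q => e q j) (g.dotDu e' (fun q => e q i) f) p
          - g.dotDu e' f (g.dotDu e' (fun q => e q i) fun q => e q j) p)
      = -2 * Coord.laplacian (g.gram e') (f ∘ e'.symm) (e' p) := by
  set P := (g.gram e' (e' p))⁻¹ with hP
  set J := jacobian e' e p with hJ
  have hgrad : ∀ i c, Coord.grad (g.gram e') ((fun q => e q i) ∘ e'.symm) (e' p) c
      = (P * J) c i := by
    intro i c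
    simp only [Coord.grad, pd_coordinate he hp he' hp', Matrix.mul_apply, hP, hJ]
  have hPt : P.transpose = P := by
    ext c d
    exact (g.isMetricOn he').inv_symm (e'.map_source hp') d c
  -- The identity ∑ g_ij ∇x^i ⊗ ∇x^j = g⁻¹ for the coordinates x^i of `e`, read in `e'`: pairing the
  -- Hessian with the left side takes its trace.
  have hsum : P * J * g.gram e (e p) * (P * J).transpose = P := by
    rw [Matrix.transpose_mul, hPt, mul_assoc P, ← mul_assoc (P * _), mul_assoc P (_ * _),
      ← g.gram_change_chart hp' he hp, (g.isMetricOn he').inv_mul (e'.map_source hp'), one_mul]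
  simp only [← g.koszul he' hp' (contMDiffAt_coordinate (n := 2) he hp _)
    (contMDiffAt_coordinate (n := 2) he hp _) hf, hgrad]
  have hcd : ∀ c d, ∑ i, ∑ j, g.gram e (e p) i j * ((P * J) c i * (P * J) d j) = P c d := by
    intro c d
    conv_rhs => rw [← hsum]
    simp only [Matrix.mul_apply (M := P * J * _), Matrix.mul_apply (M := P * J) (N := g.gram e _),
      Matrix.transpose_apply, Finset.sum_mul]
    rw [Finset.sum_comm]
    exact Finset.sum_congr rfl fun i _ => Finset.sum_congr rfl fun j _ => by ring
  simp only [Coord.laplacian, ← hP, ← hcd, Finset.sum_mul, Finset.mul_sum, neg_mul, mul_neg,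
    Finset.sum_neg_distrib, neg_neg]
  rw [sum_comm_pairs]
  exact Finset.sum_congr rfl fun c _ => Finset.sum_congr rfl fun d _ =>
    Finset.sum_congr rfl fun i _ => Finset.sum_congr rfl fun j _ => by ring

/-- The Laplacian does not depend on the chart. -/
theorem laplacian_eq_of_charts (he : e ∈ atlas (E m) M) (hp : p ∈ e.source)
    (he' : e' ∈ atlas (E m) M) (hp' : p ∈ e'.source) (hf : ContMDiffAt (𝓡 m) 𝓘(ℝ, ℝ) 2 f p) :
    Coord.laplacian (g.gram e) (f ∘ e.symm) (e p)
      = Coord.laplacian (g.gram e') (f ∘ e'.symm) (e' p) := by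
  have hc : ∀ i, ContMDiffAt (𝓡 m) 𝓘(ℝ, ℝ) 2 (fun q => e q i) p :=
    contMDiffAt_coordinate (n := 2) he hp
  -- The coefficients and the functions x^i come from `e` in both uses of the formula; only the
  -- chart computing the iterated products changes, and these are invariant.
  have h := g.sum_gram_mul_koszul he hp he hp hf
  simp only [g.dotDu_dotDu_eq_of_charts he hp he' hp' (hc _) hf (hc _),
    g.dotDu_dotDu_eq_of_charts he hp he' hp' (hc _) (hc _) hf,
    g.sum_gram_mul_koszul he hp he' hp' hf] at h
  linarith

end SmoothMetric

/-! ### Laplacian of |df|² - f² and norms of bilinear forms -/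

namespace Coord

variable {m : ℕ} {G : (E m) → Matrix (Fin m) (Fin m) ℝ} {f h : (E m) → ℝ} {x : E m}

theorem laplacian_congr (hfh : f =ᶠ[𝓝 x] h) : laplacian G f x = laplacian G h x := by
  simp only [laplacian, hessian, pd_congr _ (pd_eventuallyEq _ hfh), pd_congr _ hfh]

theorem eventually_differentiableAt (hf : ContDiffAt ℝ 2 f x) :
    ∀ᶠ y in 𝓝 x, DifferentiableAt ℝ f y :=
  (hf.eventually (by simp)).mono fun _ hy => hy.differentiableAt (by norm_num)

theorem laplacian_sub (hf : ContDiffAt ℝ 2 f x) (hh : ContDiffAt ℝ 2 h x) :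
    laplacian G (fun y => f y - h y) x = laplacian G f x - laplacian G h x := by
  have h1 : ∀ j, pd j (fun y => f y - h y) x = pd j f x - pd j h x := fun j =>
    pd_sub j (hf.differentiableAt (by norm_num)) (hh.differentiableAt (by norm_num))
  have h2 : ∀ i j, pd i (pd j fun y => f y - h y) x = pd i (pd j f) x - pd i (pd j h) x := by
    intro i j
    rw [← pd_sub i (IsMetricOn.differentiableAt_pd hf j) (IsMetricOn.differentiableAt_pd hh j)]
    apply pd_congr
    filter_upwards [eventually_differentiableAt hf, eventually_differentiableAt hh] with y hy hy'
    exact pd_sub j hy hy'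
  simp only [laplacian, hessian, h1, h2, mul_sub, Finset.sum_sub_distrib]
  ring

theorem laplacian_sq (hf : ContDiffAt ℝ 2 f x) :
    laplacian G (fun y => f y ^ 2) x = 2 * f x * laplacian G f x - 2 * dot G f f x := by
  have hd := hf.differentiableAt (by norm_num)
  have h0 : ∀ y, DifferentiableAt ℝ f y → ∀ j, pd j (fun y => f y ^ 2) y = 2 * (f y * pd j f y) := by
    intro y hy j
    simp only [sq]
    rw [pd_mul j hy hy]
    ring
  have h2 : ∀ i j, pd i (pd j fun y => f y ^ 2) x
      = 2 * (pd i f x * pd j f x + f x * pd i (pd j f) x) := by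
    intro i j
    have hj := IsMetricOn.differentiableAt_pd hf j
    rw [← pd_mul i hd hj, ← pd_const_mul i 2 (hd.fun_mul hj)]
    exact pd_congr i ((eventually_differentiableAt hf).mono fun y hy => h0 y hy j)
  have h3 : ∀ i j, hessian G (fun y => f y ^ 2) i j x
      = 2 * f x * hessian G f i j x + 2 * (pd i f x * pd j f x) := by
    intro i j
    simp only [hessian, h2, h0 x hd, mul_sub, Finset.mul_sum]
    have : ∀ k, christoffel G k i j x * (2 * (f x * pd k f x))
        = 2 * f x * (christoffel G k i j x * pd k f x) := fun k => by ring
    simp only [this]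
    ring
  simp only [laplacian, h3, dot, mul_add, Finset.sum_add_distrib, mul_neg, Finset.mul_sum]
  rw [neg_add, sub_eq_add_neg]
  congr 2
  · exact Finset.sum_congr rfl fun i _ => Finset.sum_congr rfl fun j _ => by ring
  · exact Finset.sum_congr rfl fun i _ => Finset.sum_congr rfl fun j _ => by ring

theorem sum_contract_eq_trace {ι : Type*} [Fintype ι] (P A B : Matrix ι ι ℝ) :
    ∑ i, ∑ j, ∑ k, ∑ l, P i k * P j l * A i j * B k l
      = (A.transpose * P * B * P.transpose).trace := by
  simp only [Matrix.trace, Matrix.diag, Matrix.mul_apply, Matrix.transpose_apply, Finset.sum_mul]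
  rw [Finset.sum_comm]
  refine Finset.sum_congr rfl fun j _ => ?_
  calc ∑ i, ∑ k, ∑ l, P i k * P j l * A i j * B k l
      = ∑ i, ∑ l, ∑ k, P i k * P j l * A i j * B k l :=
        Finset.sum_congr rfl fun i _ => Finset.sum_comm
    _ = ∑ l, ∑ i, ∑ k, P i k * P j l * A i j * B k l := Finset.sum_comm
    _ = ∑ l, ∑ k, ∑ i, P i k * P j l * A i j * B k l :=
        Finset.sum_congr rfl fun i _ => Finset.sum_comm
    _ = _ := Finset.sum_congr rfl fun i _ => Finset.sum_congr rfl fun k _ =>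
        Finset.sum_congr rfl fun l _ => by ring

open scoped MatrixOrder Matrix.Norms.L2Operator in
-- Writing P = C*C, cyclicity of the trace turns tr(AᵀPAP) into tr(C(AᵀPA)C*), the trace of a
-- positive semidefinite matrix.
theorem sum_contract_nonneg {ι : Type*} [Fintype ι] [DecidableEq ι] {P : Matrix ι ι ℝ}
    (hP : P.PosSemidef) (A : Matrix ι ι ℝ) :
    0 ≤ ∑ i, ∑ j, ∑ k, ∑ l, P i k * P j l * A i j * A k l := by
  rw [sum_contract_eq_trace]
  have hPt : P.transpose = P := by
    have := hP.isHermitian.eq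
    rwa [Matrix.conjTranspose_eq_transpose_of_trivial] at this
  have hX : (A.transpose * P * A).PosSemidef := by
    have := hP.conjTranspose_mul_mul_same A
    rwa [Matrix.conjTranspose_eq_transpose_of_trivial] at this
  obtain ⟨C, hC⟩ := CStarAlgebra.nonneg_iff_eq_star_mul_self.mp hP.nonneg
  rw [hPt]
  nth_rewrite 2 [hC]
  rw [← mul_assoc, Matrix.trace_mul_comm, ← mul_assoc]
  exact (hX.mul_mul_conjTranspose_same C).trace_nonneg

/-- The squared norm of a multiple of the metric added to a bilinear form. -/
theorem sum_contract_add_smul {ι : Type*} [Fintype ι] [DecidableEq ι] {P g : Matrix ι ι ℝ}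
    (hP : P.transpose = P) (hg : g.transpose = g) (hPg : P * g = 1) (A : Matrix ι ι ℝ) (c : ℝ) :
    ∑ i, ∑ j, ∑ k, ∑ l, P i k * P j l * (A i j + c * g i j) * (A k l + c * g k l)
      = (∑ i, ∑ j, ∑ k, ∑ l, P i k * P j l * A i j * A k l)
        + 2 * c * (∑ i, ∑ j, P i j * A i j) + c ^ 2 * Fintype.card ι := by
  have h := sum_contract_eq_trace P (A + c • g) (A + c • g)
  have hgP : g * P = 1 := _root_.mul_eq_one_comm.1 hPg
  simp only [Matrix.add_apply, Matrix.smul_apply, smul_eq_mul] at h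
  rw [h, sum_contract_eq_trace]
  have h1 : (A.transpose * P).trace = ∑ i, ∑ j, P i j * A i j := by
    simp only [Matrix.trace, Matrix.diag, Matrix.mul_apply, Matrix.transpose_apply]
    rw [Finset.sum_comm]
    exact Finset.sum_congr rfl fun i _ => Finset.sum_congr rfl fun j _ => mul_comm _ _
  have h2 : (A * P).trace = (A.transpose * P).trace := by
    rw [← Matrix.trace_transpose, Matrix.transpose_mul, hP, Matrix.trace_mul_comm]
  rw [← h1]
  simp only [Matrix.transpose_add, Matrix.transpose_smul, hP, hg, add_mul, mul_add, Matrix.smul_mul,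
    Matrix.mul_smul, hgP, one_mul, Matrix.trace_add, Matrix.trace_smul, h2, smul_eq_mul,
    mul_assoc A.transpose, hPg, mul_one, Matrix.trace_one]
  ring

namespace IsMetricOn

variable {U : Set (E m)}

/-- Bochner's formula for an eigenfunction. -/
theorem laplacian_dot_sub_sq (hG : IsMetricOn G U) (hx : x ∈ U) (hf : ContDiffAt ℝ 3 f x) (c : ℝ)
    (hlap : laplacian G f =ᶠ[𝓝 x] fun y => -c * f y) :
    laplacian G (fun y => dot G f f y - f y ^ 2) x
      = -2 * (∑ i, ∑ j, ∑ k, ∑ l, (G x)⁻¹ i k * (G x)⁻¹ j l * hessian G f i j x * hessian G f k l x)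
        - 2 * ((∑ i, ∑ j, ricci G i j x * grad G f x i * grad G f x j) + (c - 1) * dot G f f x)
        + 2 * c * f x ^ 2 := by
  have hf2 : ContDiffAt ℝ 2 f x := hf.of_le (by norm_num)
  have h1 : ∀ i, pd i (laplacian G f) x = -c * pd i f x := fun i => by
    rw [pd_congr i hlap, pd_const_mul i _ (hf.differentiableAt (by norm_num))]
  have h2 : ∑ i, grad G f x i * pd i (laplacian G f) x = -c * dot G f f x := by
    rw [dot_eq_sum_mul_grad, Finset.mul_sum]
    exact Finset.sum_congr rfl fun i _ => by rw [h1]; ring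
  have hdot : ContDiffAt ℝ 2 (dot G f f) x := hG.dot_contDiffAt (n := 2) hx
    (by exact_mod_cast hf) (by exact_mod_cast hf)
  -- In the factor `c - 1` of |df|², `c` comes from ⟨df, dΔf⟩ and `-1` from the gradient term of
  -- Δ(f²).
  rw [laplacian_sub hdot (hf2.pow 2), laplacian_sq hf2, hG.bochner hx hf, h2, hlap.self_of_nhds]
  ring

end IsMetricOn

end Coord

/-! ### The identity and its sign on the manifold -/

namespace SmoothMetric

variable {m : ℕ} {M : Type*} [TopologicalSpace M] [ChartedSpace (E m) M]
  [IsManifold (𝓡 m) ∞ M] (g : SmoothMetric m M) {u : M → ℝ} {p : M}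

/-- `normSqDu` changes chart from point to point; near `p` it can be read in one fixed chart and so
differentiated. -/
theorem normSqDu_eventuallyEq {e : OpenPartialHomeomorph M (E m)} (he : e ∈ atlas (E m) M)
    (hp : p ∈ e.source) (hu : ContMDiff (𝓡 m) 𝓘(ℝ, ℝ) 1 u) :
    g.normSqDu u =ᶠ[𝓝 p] g.dotDu e u u := by
  filter_upwards [e.open_source.mem_nhds hp] with q hq
  exact g.dotDu_eq_of_charts (chart_mem_atlas _ q) (mem_chart_source _ q) he hq
    (hu.mdifferentiableAt (by norm_num)) (hu.mdifferentiableAt (by norm_num))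

theorem normSqDu_contMDiff {n : ℕ} (hu : ContMDiff (𝓡 m) 𝓘(ℝ, ℝ) (n + 1 : ℕ) u) :
    ContMDiff (𝓡 m) 𝓘(ℝ, ℝ) n (g.normSqDu u) := fun p =>
  (g.dotDu_contMDiffAt (chart_mem_atlas _ p) (mem_chart_source _ p) (hu p) (hu p)).congr_of_eventuallyEq
    (g.normSqDu_eventuallyEq (chart_mem_atlas _ p) (mem_chart_source _ p)
      (hu.of_le (by exact_mod_cast Nat.le_add_left 1 n)))

theorem normSqTracelessHessian_nonneg (p : M) : 0 ≤ g.normSqTracelessHessian u p :=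
  Coord.sum_contract_nonneg
    (g.gram_posDef (chart_mem_atlas _ p) (mem_chart_source _ p)).inv.posSemidef
    (Matrix.of fun i j => g.tracelessHessian u p i j)

/-- Adding (Δu/m)g to a form of trace -Δu changes the squared norm by -2(Δu)²/m + (Δu)²/m. -/
theorem normSqTracelessHessian_eq (hm : m ≠ 0) (u : M → ℝ) (p : M) :
    g.normSqTracelessHessian u p
      = (let e := chartAt (E m) p
        ∑ i, ∑ j, ∑ k, ∑ l, (g.gram e (e p))⁻¹ i k * (g.gram e (e p))⁻¹ j l
          * Coord.hessian (g.gram e) (u ∘ e.symm) i j (e p)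
          * Coord.hessian (g.gram e) (u ∘ e.symm) k l (e p)) - g.laplacian u p ^ 2 / m := by
  have hG := g.isMetricOn (chart_mem_atlas (E m) p)
  have hx := (chartAt (E m) p).map_source (mem_chart_source (E m) p)
  have h := Coord.sum_contract_add_smul (P := (g.gram (chartAt (E m) p) (chartAt (E m) p p))⁻¹)
    (g := g.gram (chartAt (E m) p) (chartAt (E m) p p)) (Matrix.ext fun i j => hG.inv_symm hx j i)
    (Matrix.ext fun i j => hG.symm _ hx j i) (hG.inv_mul hx)
    (Matrix.of fun i j => Coord.hessian (g.gram (chartAt (E m) p)) (u ∘ (chartAt (E m) p).symm) i j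
      (chartAt (E m) p p)) (1 / m * g.laplacian u p)
  refine h.trans ?_
  have htr : ∑ i, ∑ j, (g.gram (chartAt (E m) p) (chartAt (E m) p p))⁻¹ i j *
      Coord.hessian (g.gram (chartAt (E m) p)) (u ∘ (chartAt (E m) p).symm) i j
        (chartAt (E m) p p) = -g.laplacian u p := (neg_neg _).symm
  have hm' : (m : ℝ) ≠ 0 := Nat.cast_ne_zero.2 hm
  simp only [Matrix.of_apply, htr, Fintype.card_fin]
  field_simp
  ring

/-- The curvature bound is applied to the gradient vector ∑ u^i ∂_i, whose squared length is |du|²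
because lowering its index returns du (`h3`). -/
theorem ricciAddDuDu_nonneg {c : ℝ} {p : M}
    (hRc : ∀ v : TangentSpace (𝓡 m) p, -c * g.inner p v v ≤ g.ricci p v v) (u : M → ℝ) :
    0 ≤ g.ricciAddDuDu c u p := by
  have he := chart_mem_atlas (E m) p
  have hp := mem_chart_source (E m) p
  set e := chartAt (E m) p with he_def
  have hG := g.isMetricOn he
  have hx := e.map_source hp
  set w : E m := WithLp.toLp 2 (g.gradComp u p) with hw
  have hc := comp_sum_smul_frame he hp w
  have h := hRc (∑ i, w i • frame e p i)
  have h1 : g.ricci p (∑ i, w i • frame e p i) (∑ i, w i • frame e p i)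
      = ∑ i, ∑ j, Coord.ricci (g.gram e) i j (e p) * comp e p (∑ i, w i • frame e p i) i
        * comp e p (∑ i, w i • frame e p i) j := rfl
  rw [h1, g.inner_eq_sum_gram he hp, hc] at h
  have h2 : ∑ i, ∑ j, g.gram e (e p) i j * w i * w j = g.normSqDu u p := by
    have h3 : ∀ i, ∑ j, g.gram e (e p) i j * w j = Coord.pd i (u ∘ e.symm) (e p) := by
      intro i
      have := congrFun (congrArg (fun A : Matrix (Fin m) (Fin m) ℝ => A.mulVec fun l =>
        Coord.pd l (u ∘ e.symm) (e p)) (hG.mul_inv hx)) i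
      simp only [Matrix.one_mulVec, ← Matrix.mulVec_mulVec] at this
      exact this
    calc ∑ i, ∑ j, g.gram e (e p) i j * w i * w j
        = ∑ i, Coord.pd i (u ∘ e.symm) (e p) * w i := by
          refine Finset.sum_congr rfl fun i _ => ?_
          rw [← h3, Finset.sum_mul]
          exact Finset.sum_congr rfl fun j _ => by ring
      _ = g.normSqDu u p := (Coord.dot_eq_sum_mul_grad _ _ _ _).symm
  rw [h2] at h
  change 0 ≤ (∑ i, ∑ j, Coord.ricci (g.gram e) i j (e p) * w i * w j) + c * g.normSqDu u p
  linarith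

/-- The term 2mu² left by Bochner's formula equals 2(Δu)²/m, exactly what separates |∇²u|² from
|b|². -/
theorem laplacian_normSqDu_sub_sq (hm : m ≠ 0) (hu : ContMDiff (𝓡 m) 𝓘(ℝ, ℝ) 3 u)
    (hsol : ∀ p, g.laplacian u p = -(m : ℝ) * u p) (p : M) :
    g.laplacian (fun q => g.normSqDu u q - u q ^ 2) p
      = -2 * g.ricciAddDuDu (m - 1) u p - 2 * g.normSqTracelessHessian u p := by
  have he := chart_mem_atlas (E m) p
  have hp := mem_chart_source (E m) p
  rw [g.normSqTracelessHessian_eq hm, hsol]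
  set e := chartAt (E m) p with he_def
  have hu2 : ContMDiff (𝓡 m) 𝓘(ℝ, ℝ) 2 u := hu.of_le (by norm_num)
  -- The equation is given at each point in that point's own chart; invariance of the Laplacian
  -- makes it an equation near `e p` in the single chart `e`, which can be differentiated.
  have hlap : Coord.laplacian (g.gram e) (u ∘ e.symm) =ᶠ[𝓝 (e p)]
      fun y => -(m : ℝ) * (u ∘ e.symm) y := by
    filter_upwards [e.open_target.mem_nhds (e.map_source hp)] with y hy
    have h := g.laplacian_eq_of_charts he (e.map_target hy) (chart_mem_atlas _ (e.symm y))
      (mem_chart_source _ (e.symm y)) (hu2 _)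
    rw [e.right_inv hy] at h
    exact h.trans (hsol _)
  have hfun : (fun q => g.normSqDu u q - u q ^ 2) ∘ e.symm =ᶠ[𝓝 (e p)]
      fun y => Coord.dot (g.gram e) (u ∘ e.symm) (u ∘ e.symm) y - (u ∘ e.symm) y ^ 2 := by
    filter_upwards [comp_symm_eventuallyEq hp
      (g.normSqDu_eventuallyEq he hp (hu.of_le (by norm_num))),
      g.dotDu_comp_symm_eventuallyEq (a := u) (b := u) hp] with y h1 h2
    simp only [Function.comp_apply] at h1 h2 ⊢
    rw [h1, h2]
  have h := (g.isMetricOn he).laplacian_dot_sub_sq (e.map_source hp)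
    (contDiffAt_comp_symm (n := 3) he hp (hu p)) m hlap
  have h0 : (u ∘ e.symm) (e p) = u p := by simp only [Function.comp_apply, e.left_inv hp]
  rw [h0] at h
  refine (Coord.laplacian_congr hfun).trans (h.trans ?_)
  have hric : g.ricciAddDuDu (m - 1) u p = (∑ i, ∑ j, Coord.ricci (g.gram e) i j (e p)
      * Coord.grad (g.gram e) (u ∘ e.symm) (e p) i * Coord.grad (g.gram e) (u ∘ e.symm) (e p) j)
      + (m - 1) * Coord.dot (g.gram e) (u ∘ e.symm) (u ∘ e.symm) (e p) := rfl
  have hm' : (m : ℝ) ≠ 0 := Nat.cast_ne_zero.2 hm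
  rw [hric]
  field_simp
  ring

end SmoothMetric

end

theorem proposition4p2 (n : ℕ) {M : Type*} [TopologicalSpace M]
    [ChartedSpace (EuclideanSpace ℝ (Fin (n + 1))) M] [IsManifold (𝓡 (n + 1)) ∞ M]
    (g : SmoothMetric (n + 1) M)
    (hRc : ∀ (p : M) (v : TangentSpace (𝓡 (n + 1)) p),
      -(n : ℝ) * g.inner p v v ≤ g.ricci p v v)
    (u : M → ℝ) (hu : ContMDiff (𝓡 (n + 1)) 𝓘(ℝ, ℝ) 3 u)
    (hsol : ∀ p, g.laplacian u p + ((n : ℝ) + 1) * u p = 0) :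
    g.IsSubharmonic (fun p => g.normSqDu u p - u p ^ 2) ∧
      ∀ p, g.laplacian (fun q => g.normSqDu u q - u q ^ 2) p
        = -2 * g.ricciAddDuDu n u p - 2 * g.normSqTracelessHessian u p := by
  have key : ∀ p, g.laplacian (fun q => g.normSqDu u q - u q ^ 2) p
      = -2 * g.ricciAddDuDu n u p - 2 * g.normSqTracelessHessian u p := by
    intro p
    have h := g.laplacian_normSqDu_sub_sq n.succ_ne_zero hu
      (fun p => by push_cast; linarith [hsol p]) p
    rwa [show ((n + 1 : ℕ) : ℝ) - 1 = n by push_cast; ring] at h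
  refine ⟨⟨?_, fun p => ?_⟩, key⟩
  · exact (g.normSqDu_contMDiff (n := 2) hu).sub ((hu.of_le (by norm_num)).pow 2)
  · rw [key]
    linarith [g.ricciAddDuDu_nonneg (hRc p) u, g.normSqTracelessHessian_nonneg (u := u) p]
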